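/- For each $n$ let $d=d(n)$, $p=p(n)$ be positive integers with $d<n^{1/2}$ (for all sufficiently large $n$), let $N=\binom nd$, and suppose $\gamma_n=N/p\to\gamma\in(0,\infty)$ as $n\to\infty$. Let $x=x(n)$ be a real random variable with $x\overset{d}{=}-x$, $\mathbb E[x^2]=1$ and $\mathbb E[x^{2k}]\le (Ck)^k$ for all integers $k\ge 1$, where $C=C(n)\ge 2$ satisfies $\lim_{n\to\infty}\frac{\log C}{\log (n^{1/2}/d)}=0$. Let $Z_1,\dots,Z_p$ be i.i.d. random vectors in $\mathbb R^N$, with coordinates indexed by the tuples $1\le i_1<\dots<i_d\le n$, each distributed as the vector $(x_{i_1}x_{i_2}\cdots x_{i_d})_{i_1<\dots<i_d}$, where $x_1,\dots,x_n$ are i.i.d. copies of $x$. For $z\in\mathbb C$ with $\operatorname{Im} z>0$ put $$S=\frac1p\sum_{j=1}^p Z_jZ_j^T,\qquad R_1=\Big(zI-S+\frac1pZ_1Z_1^T\Big)^{-1},\qquad m_{F_n}(z)=\frac1N\operatorname{tr}\big((zI-S)^{-1}\big),\qquad m_\gamma(z)=\int\frac{1}{z-t}\,dF_\gamma(t),$$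 where $F_\gamma$ is the Marchenko--Pastur law with parameter $\gamma$, that is, the probability measure on $\mathbb R$ with density $\frac{\sqrt{((1+\sqrt\gamma)^2-y)(y-(1-\sqrt\gamma)^2)}}{2\pi\gamma y}$ on $[(1-\sqrt\gamma)^2,(1+\sqrt\gamma)^2]$ together with, if $\gamma>1$, an atom of mass $1-\frac1\gamma$ at $0$. Then, for every fixed $z$ with $\operatorname{Im} z\ge 1+4\gamma$, for all sufficiently large $n$ the quantities below are well defined (no denominator vanishes and the random variables are integrable), and as $n\to\infty$ $$\mathbb E\Big[\frac{1}{1-\frac1pZ_1^TR_1Z_1}\Big]=\frac{1}{1-\gamma_n\mathbb E[m_{F_n}(z)]}+o(1).$$ Moreover, for every fixed $z$ with $\operatorname{Im} z\ge \frac{16}{9}+4\gamma$, $$\mathbb E[m_{F_n}(z)]=m_\gamma(z)+o(1)\qquad(n\to\infty).$$ -/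

import Mathlib

open MeasureTheory ProbabilityTheory Filter Topology

noncomputable section

namespace RandomTensor

/-- The row labels: the `d`-element subsets `{i₁ < ⋯ < i_d}` of an `n`-element set. There are
`n.choose d` of them. -/
abbrev Row (n d : ℕ) : Type := {s : Finset (Fin n) // s.card = d}

/-- The vector with entries `x_{i₁} x_{i₂} ⋯ x_{i_d}`, `i₁ < ⋯ < i_d`. -/
def tensorVec (n d : ℕ) (x : Fin n → ℝ) : Row n d → ℝ := fun s => ∏ i ∈ s.1, x i

/-- The law of `tensorVec n d (x₁, …, x_n)` for i.i.d. `x₁, …, x_n` with law `ν`. -/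
def tensorLaw (n d : ℕ) (ν : Measure ℝ) : Measure (Row n d → ℝ) :=
  (Measure.pi fun _ : Fin n => ν).map (tensorVec n d)

/-- `S = (1/p) ∑ⱼ Zⱼ Zⱼᵀ`, where `Zⱼ` are the columns of `Z`. -/
def sampleCov {ι : Type*} {p : ℕ} (Z : Fin p → ι → ℝ) : Matrix ι ι ℝ :=
  (p : ℝ)⁻¹ • ∑ j, Matrix.vecMulVec (Z j) (Z j)

/-- The resolvent `(zI - A)⁻¹` of a real matrix `A`. -/
def realResolvent {ι : Type*} [Fintype ι] [DecidableEq ι] (A : Matrix ι ι ℝ) (z : ℂ) :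
    Matrix ι ι ℂ :=
  (z • (1 : Matrix ι ι ℂ) - A.map Complex.ofReal)⁻¹

/-- The Stieltjes transform `(1/N) tr (zI - A)⁻¹` of the empirical spectral distribution of a
real symmetric `N × N` matrix `A`. -/
def stieltjesESD {ι : Type*} [Fintype ι] [DecidableEq ι] (A : Matrix ι ι ℝ) (z : ℂ) : ℂ :=
  (Fintype.card ι : ℂ)⁻¹ * (realResolvent A z).trace

/-- `Rⱼ = (zI - S + (1/p) Zⱼ Zⱼᵀ)⁻¹`. -/
def looResolvent {ι : Type*} [Fintype ι] [DecidableEq ι] {p : ℕ} (Z : Fin p → ι → ℝ)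
    (j : Fin p) (z : ℂ) : Matrix ι ι ℂ :=
  realResolvent (sampleCov Z - (p : ℝ)⁻¹ • Matrix.vecMulVec (Z j) (Z j)) z

/-- `(1/p) Zⱼᵀ Rⱼ Zⱼ`. -/
def quadForm {ι : Type*} [Fintype ι] [DecidableEq ι] {p : ℕ} (Z : Fin p → ι → ℝ)
    (j : Fin p) (z : ℂ) : ℂ :=
  (p : ℂ)⁻¹ * ((fun i => (Z j i : ℂ)) ⬝ᵥ
    (looResolvent Z j z).mulVec (fun i => (Z j i : ℂ)))

/-- The density of the absolutely continuous part of the Marchenko–Pastur law. -/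
def mpDensity (γ y : ℝ) : ℝ :=
  open Classical in
  if y ∈ Set.Icc ((1 - √γ) ^ 2) ((1 + √γ) ^ 2) then
    √(((1 + √γ) ^ 2 - y) * (y - (1 - √γ) ^ 2)) / (2 * Real.pi * γ * y)
  else 0

/-- The Marchenko–Pastur law with parameter `γ > 0`: the density above plus, when `γ > 1`, an atom
of mass `1 - 1/γ` at `0` (`ENNReal.ofReal` makes that mass `0` when `γ ≤ 1`). -/
def mpLaw (γ : ℝ) : Measure ℝ :=
  volume.withDensity (fun y => ENNReal.ofReal (mpDensity γ y)) +
    ENNReal.ofReal (1 - 1 / γ) • Measure.dirac 0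

/-- The Stieltjes transform `∫ (z - x)⁻¹ dμ(x)` of a measure on the line. -/
def stieltjes (μ : Measure ℝ) (z : ℂ) : ℂ := ∫ x : ℝ, (z - (x : ℂ))⁻¹ ∂μ

end RandomTensor

end

noncomputable section

namespace RandomTensor

/-! ### Resolvents of real positive semidefinite matrices and rank one updates. -/

section Resolvent

variable {ι : Type*} [Fintype ι]

/-! Write N for the number of rows, g = N/p, M = E[m_{F_n}(z)] and q_j = (1/p) Z_jᵀ R_j Z_j; the
column called 1 in the text has index 0 in the code. The core of the proof is that q_1 is close in
L¹ to the constant gM (`integral_norm_quadForm_sub_le`).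

Once the other columns are frozen, R_1 is a fixed matrix A whose columns have norm at most 1/Im z.
The second moment of Z_1ᵀ A Z_1 - tr A is governed by covariances of products Z_s Z_t. Vanishing odd
moments kill the covariance with Z_u Z_v unless s Δ t = u Δ v, and otherwise it is controlled by (1
+ L)^k - 1, where k is the size of an intersection and L = 4C² - 1. Averaging over d-sets gives the
bound N² (Im z)⁻² (exp(2d²L/n) - 1) (`integral_norm_sq_quadratic_sub_trace_le`), and the growth
condition on C forces d²C²/n → 0. Replacing tr R_1 by tr (zI - S)⁻¹ is a rank one perturbation
costing at most 1/Im z, and replacing m_{F_n} by its mean is an Efron–Stein estimate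
(`variance_pi_le`). Since 1/(1 - q_1) is bounded by |z|/Im z everywhere, L¹ closeness yields the
first limit.

For the second limit, the trace of (zI - S)(zI - S)⁻¹ = I together with Sherman–Morrison and
exchangeability gives the exact relation E[1/(1 - q_1)] = gzM + 1 - g
(`trace_realResolvent_sampleCov`). So M solves the Marchenko–Pastur equation up to an error δ → 0.
The transform m of the limit law is computed explicitly through a Joukowski parameter u with |u| < 1
(`exists_stieltjes_mpLaw_eq`). Subtracting the two equations bounds |z||M - m| by (4/3)(1 + √γ)|M -
m| plus vanishing terms, and Im z exceeds that factor by at least 1/3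
(`norm_sub_stieltjes_mpLaw_le`). The convergence is thus quantitative and needs no compactness
argument. -/

lemma star_dotProduct_self_eq (w : ι → ℂ) : star w ⬝ᵥ w = ((∑ i, ‖w i‖ ^ 2 : ℝ) : ℂ) := by
  simp only [dotProduct, Pi.star_apply, Complex.ofReal_sum, Complex.ofReal_pow]
  refine Finset.sum_congr rfl fun i _ => ?_
  rw [← Complex.conj_mul']
  rfl

lemma norm_star_dotProduct_le (w v : ι → ℂ) :
    ‖star w ⬝ᵥ v‖ ^ 2 ≤ (∑ i, ‖w i‖ ^ 2) * ∑ i, ‖v i‖ ^ 2 := by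
  have h : ‖star w ⬝ᵥ v‖ ≤ ∑ i, ‖w i‖ * ‖v i‖ := by
    refine (norm_sum_le _ _).trans (le_of_eq (Finset.sum_congr rfl fun i _ => ?_))
    simp
  calc ‖star w ⬝ᵥ v‖ ^ 2 ≤ (∑ i, ‖w i‖ * ‖v i‖) ^ 2 := by gcongr
    _ ≤ _ := Finset.sum_mul_sq_le_sq_mul_sq _ _ _

/-- The Hermitian form of a real positive semidefinite matrix is real and nonnegative. -/
lemma exists_nonneg_star_dotProduct_map {A : Matrix ι ι ℝ} (hA : A.PosSemidef) (w : ι → ℂ) :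
    ∃ r : ℝ, 0 ≤ r ∧ star w ⬝ᵥ ((A.map Complex.ofReal).mulVec w) = r := by
  have hsymm : ∀ i j, A i j = A j i := fun i j => by
    simpa using (hA.isHermitian.apply i j).symm
  have ha := hA.dotProduct_mulVec_nonneg fun i => (w i).re
  have hb := hA.dotProduct_mulVec_nonneg fun i => (w i).im
  refine ⟨_, add_nonneg ha hb, ?_⟩
  simp only [dotProduct, Matrix.mulVec, Pi.star_apply, Matrix.map_apply, Finset.mul_sum,
    star_trivial]
  apply Complex.ext
  · simp only [Complex.re_sum, Complex.ofReal_re, ← Finset.sum_add_distrib]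
    refine Finset.sum_congr rfl fun i _ => Finset.sum_congr rfl fun j _ => ?_
    simp
  · simp only [Complex.im_sum, Complex.ofReal_im]
    have h1 : ∑ i, ∑ j, A i j * ((w i).re * (w j).im) =
        ∑ i, ∑ j, A i j * ((w i).im * (w j).re) := by
      rw [Finset.sum_comm]
      refine Finset.sum_congr rfl fun i _ => Finset.sum_congr rfl fun j _ => ?_
      rw [hsymm]
      ring
    rw [← sub_eq_zero, ← Finset.sum_sub_distrib] at h1
    rw [← h1]
    refine Finset.sum_congr rfl fun i _ => ?_
    rw [← Finset.sum_sub_distrib]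
    refine Finset.sum_congr rfl fun j _ => ?_
    simp
    ring

variable [DecidableEq ι]

/-- The source of every resolvent bound below: A contributes only a real number, so the imaginary
part is exactly Im z times the squared norm of w. The sign of r matters only for the lower bound on
|1 - c vᵀRv|. -/
lemma exists_star_dotProduct_shift {A : Matrix ι ι ℝ} (hA : A.PosSemidef) (z : ℂ) (w : ι → ℂ) :
    ∃ r : ℝ, 0 ≤ r ∧ star w ⬝ᵥ ((z • (1 : Matrix ι ι ℂ) - A.map Complex.ofReal).mulVec w) =
      z * ((∑ i, ‖w i‖ ^ 2 : ℝ) : ℂ) - r := by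
  obtain ⟨r, hr, h⟩ := exists_nonneg_star_dotProduct_map hA w
  refine ⟨r, hr, ?_⟩
  rw [Matrix.sub_mulVec, dotProduct_sub, h, Matrix.smul_mulVec, Matrix.one_mulVec,
    dotProduct_smul, star_dotProduct_self_eq, smul_eq_mul]

lemma isUnit_det_shift {A : Matrix ι ι ℝ} (hA : A.PosSemidef) {z : ℂ} (hz : 0 < z.im) :
    IsUnit (z • (1 : Matrix ι ι ℂ) - A.map Complex.ofReal).det := by
  rw [isUnit_iff_ne_zero]
  intro h0
  obtain ⟨v, hv, h⟩ := Matrix.exists_mulVec_eq_zero_iff.2 h0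
  obtain ⟨r, -, hr⟩ := exists_star_dotProduct_shift hA z v
  rw [h, dotProduct_zero] at hr
  have him := congrArg Complex.im hr
  simp only [Complex.zero_im, Complex.sub_im, Complex.mul_im, Complex.ofReal_re,
    Complex.ofReal_im, mul_zero, zero_add, sub_zero] at him
  have hs : ∑ i, ‖v i‖ ^ 2 = 0 := by
    rcases mul_eq_zero.1 him.symm with h | h
    · exact absurd h hz.ne'
    · exact h
  rw [Finset.sum_eq_zero_iff_of_nonneg fun i _ => by positivity] at hs
  exact hv (funext fun i => by simpa using hs i (Finset.mem_univ i))

lemma shift_mul_realResolvent {A : Matrix ι ι ℝ} (hA : A.PosSemidef) {z : ℂ} (hz : 0 < z.im) :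
    (z • (1 : Matrix ι ι ℂ) - A.map Complex.ofReal) * realResolvent A z = 1 :=
  Matrix.mul_nonsing_inv _ (isUnit_det_shift hA hz)

lemma realResolvent_mul_shift {A : Matrix ι ι ℝ} (hA : A.PosSemidef) {z : ℂ} (hz : 0 < z.im) :
    realResolvent A z * (z • (1 : Matrix ι ι ℂ) - A.map Complex.ofReal) = 1 :=
  Matrix.nonsing_inv_mul _ (isUnit_det_shift hA hz)

lemma realResolvent_transpose {A : Matrix ι ι ℝ} (hA : A.PosSemidef) (z : ℂ) :
    (realResolvent A z).transpose = realResolvent A z := by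
  have hsymm : A.transpose = A := by simpa [Matrix.IsHermitian] using hA.isHermitian
  rw [realResolvent, Matrix.transpose_nonsing_inv, Matrix.transpose_sub, Matrix.transpose_smul,
    Matrix.transpose_one, ← Matrix.transpose_map, hsymm]

lemma exists_star_realResolvent_mulVec {A : Matrix ι ι ℝ} (hA : A.PosSemidef) {z : ℂ}
    (hz : 0 < z.im) (v : ι → ℂ) :
    ∃ r : ℝ, 0 ≤ r ∧ star ((realResolvent A z).mulVec v) ⬝ᵥ v =
      z * ((∑ i, ‖(realResolvent A z).mulVec v i‖ ^ 2 : ℝ) : ℂ) - r := by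
  obtain ⟨r, hr, h⟩ := exists_star_dotProduct_shift hA z ((realResolvent A z).mulVec v)
  refine ⟨r, hr, ?_⟩
  rwa [Matrix.mulVec_mulVec, shift_mul_realResolvent hA hz, Matrix.one_mulVec] at h

/-- The imaginary part of the pairing of Rv with v is Im z ‖Rv‖², while Cauchy–Schwarz bounds the
pairing by ‖Rv‖ ‖v‖; cancel one factor ‖Rv‖. -/
lemma sum_sq_realResolvent_mulVec_le {A : Matrix ι ι ℝ} (hA : A.PosSemidef) {z : ℂ}
    (hz : 0 < z.im) (v : ι → ℂ) :
    ∑ i, ‖(realResolvent A z).mulVec v i‖ ^ 2 ≤ (z.im)⁻¹ ^ 2 * ∑ i, ‖v i‖ ^ 2 := by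
  obtain ⟨r, -, h⟩ := exists_star_realResolvent_mulVec hA hz v
  have h2 := norm_star_dotProduct_le ((realResolvent A z).mulVec v) v
  set s := ∑ i, ‖(realResolvent A z).mulVec v i‖ ^ 2
  have hs : 0 ≤ s := Finset.sum_nonneg fun i _ => sq_nonneg _
  clear_value s
  have h1 : z.im * s ≤ ‖star ((realResolvent A z).mulVec v) ⬝ᵥ v‖ := by
    refine le_trans (le_of_eq ?_) ((le_abs_self _).trans (Complex.abs_im_le_norm _))
    rw [h, Complex.sub_im, Complex.im_mul_ofReal, Complex.ofReal_im, sub_zero]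
  have h3 : (z.im * s) ^ 2 ≤ s * ∑ i, ‖v i‖ ^ 2 :=
    (pow_le_pow_left₀ (by positivity) h1 2).trans h2
  rcases hs.eq_or_lt with h0 | h0
  · rw [← h0]
    exact mul_nonneg (by positivity) (Finset.sum_nonneg fun i _ => by positivity)
  · have h4 : z.im ^ 2 * s ≤ ∑ i, ‖v i‖ ^ 2 := by
      refine le_of_mul_le_mul_left ?_ h0
      linarith [h3, show (z.im * s) ^ 2 = s * (z.im ^ 2 * s) by ring]
    rw [inv_pow, ← div_eq_inv_mul, le_div_iff₀ (by positivity)]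
    linarith

/-- This columnwise form is what the quadratic form estimate consumes: summed over columns it bounds
the Frobenius norm. -/
lemma sum_sq_realResolvent_col_le {A : Matrix ι ι ℝ} (hA : A.PosSemidef) {z : ℂ}
    (hz : 0 < z.im) (j : ι) : ∑ i, ‖realResolvent A z i j‖ ^ 2 ≤ (z.im)⁻¹ ^ 2 := by
  have h := sum_sq_realResolvent_mulVec_le hA hz (Pi.single j 1)
  have h1 : ∑ i, ‖(Pi.single j 1 : ι → ℂ) i‖ ^ 2 = 1 := by
    rw [Finset.sum_eq_single j] <;> simp +contextual
  simpa [h1] using h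

lemma norm_realResolvent_apply_le {A : Matrix ι ι ℝ} (hA : A.PosSemidef) {z : ℂ}
    (hz : 0 < z.im) (i j : ι) : ‖realResolvent A z i j‖ ≤ (z.im)⁻¹ := by
  refine le_of_sq_le_sq ?_ (by positivity)
  exact (Finset.single_le_sum (f := fun i => ‖realResolvent A z i j‖ ^ 2)
    (fun i _ => by positivity) (Finset.mem_univ i)).trans (sum_sq_realResolvent_col_le hA hz j)

lemma norm_trace_realResolvent_le {A : Matrix ι ι ℝ} (hA : A.PosSemidef) {z : ℂ}
    (hz : 0 < z.im) : ‖(realResolvent A z).trace‖ ≤ Fintype.card ι * (z.im)⁻¹ := by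
  refine (norm_sum_le _ _).trans ((Finset.sum_le_sum fun i _ =>
    norm_realResolvent_apply_le hA hz i i).trans ?_)
  simp

lemma norm_stieltjesESD_le {A : Matrix ι ι ℝ} (hA : A.PosSemidef) {z : ℂ}
    (hz : 0 < z.im) : ‖stieltjesESD A z‖ ≤ (z.im)⁻¹ := by
  have h := norm_trace_realResolvent_le hA hz
  rw [stieltjesESD, norm_mul, norm_inv, Complex.norm_natCast]
  rcases (Nat.cast_nonneg (α := ℝ) (Fintype.card ι)).eq_or_lt with h0 | h0
  · rw [← h0]
    simp [hz.le]
  · rw [← div_eq_inv_mul, div_le_iff₀ h0]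
    linarith

/-- For real `v` the bilinear form `vᵀ R v` agrees with the conjugate of the Hermitian one. -/
lemma exists_real_quadratic_realResolvent {A : Matrix ι ι ℝ} (hA : A.PosSemidef) {z : ℂ}
    (hz : 0 < z.im) (v : ι → ℝ) :
    ∃ r : ℝ, 0 ≤ r ∧ (fun i => (v i : ℂ)) ⬝ᵥ (realResolvent A z).mulVec (fun i => (v i : ℂ)) =
      star z * ((∑ i, ‖(realResolvent A z).mulVec (fun i => (v i : ℂ)) i‖ ^ 2 : ℝ) : ℂ) - r := by
  obtain ⟨r, hr, h⟩ := exists_star_realResolvent_mulVec hA hz (fun i => (v i : ℂ))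
  refine ⟨r, hr, ?_⟩
  have h' := congrArg star h
  rw [Matrix.star_dotProduct, star_star] at h'
  convert h' using 1
  · congr 1
    funext i
    simp
  · simp

/-- `1 - c vᵀ R v` stays away from `0`. -/
lemma im_div_norm_le_norm_one_sub {A : Matrix ι ι ℝ} (hA : A.PosSemidef) {z : ℂ}
    (hz : 0 < z.im) (v : ι → ℝ) {c : ℝ} (hc : 0 ≤ c) :
    z.im / ‖z‖ ≤ ‖1 - c * ((fun i => (v i : ℂ)) ⬝ᵥ
      (realResolvent A z).mulVec (fun i => (v i : ℂ)))‖ := by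
  obtain ⟨r, hr, h⟩ := exists_real_quadratic_realResolvent hA hz v
  rw [h]
  set s := ∑ i, ‖(realResolvent A z).mulVec (fun i => (v i : ℂ)) i‖ ^ 2
  have hz0 : 0 < ‖z‖ := norm_pos_iff.2 fun h0 => by simp [h0] at hz
  rw [div_le_iff₀' hz0, ← norm_mul]
  refine le_trans ?_ ((le_abs_self _).trans (Complex.abs_im_le_norm _))
  -- Multiplying by z makes the term c z z̄ s real, so it drops out of the imaginary part; what is
  -- left is at least Im z.
  have : (z * (1 - (c : ℂ) * (star z * (s : ℂ) - r))).im = z.im + c * r * z.im := by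
    simp
    ring
  rw [this]
  have := mul_nonneg (mul_nonneg hc hr) hz.le
  linarith

/-- The left side is the exact imaginary part of 1 - c vᵀRv. This lets the Sherman–Morrison
denominator absorb ‖Rv‖² in the trace of a rank one update, with no bound on v. -/
lemma im_mul_sum_sq_le_norm_one_sub {A : Matrix ι ι ℝ} (hA : A.PosSemidef) {z : ℂ}
    (hz : 0 < z.im) (v : ι → ℝ) (c : ℝ) :
    c * z.im * ∑ i, ‖(realResolvent A z).mulVec (fun i => (v i : ℂ)) i‖ ^ 2 ≤
      ‖1 - c * ((fun i => (v i : ℂ)) ⬝ᵥ (realResolvent A z).mulVec (fun i => (v i : ℂ)))‖ := by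
  obtain ⟨r, hr, h⟩ := exists_real_quadratic_realResolvent hA hz v
  rw [h]
  set s := ∑ i, ‖(realResolvent A z).mulVec (fun i => (v i : ℂ)) i‖ ^ 2
  refine le_trans (le_of_eq ?_) ((le_abs_self _).trans (Complex.abs_im_le_norm _))
  simp
  ring

lemma map_ofReal_add_smul_vecMulVec {ι : Type*} (A : Matrix ι ι ℝ) (v : ι → ℝ) (c : ℝ) :
    (A + c • Matrix.vecMulVec v v).map Complex.ofReal = A.map Complex.ofReal +
      (c : ℂ) • Matrix.vecMulVec (fun i => (v i : ℂ)) (fun i => (v i : ℂ)) := by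
  ext i j
  simp [Matrix.vecMulVec_apply]

lemma posSemidef_add_smul_vecMulVec {ι : Type*} [Fintype ι] {A : Matrix ι ι ℝ}
    (hA : A.PosSemidef) (v : ι → ℝ) {c : ℝ} (hc : 0 ≤ c) :
    (A + c • Matrix.vecMulVec v v).PosSemidef := by
  refine hA.add (Matrix.PosSemidef.smul ?_ hc)
  simpa using Matrix.posSemidef_vecMulVec_self_star v

/-- Sherman–Morrison for the vector that is added. -/
lemma realResolvent_mulVec_eq_smul {A : Matrix ι ι ℝ} (hA : A.PosSemidef) {z : ℂ}
    (hz : 0 < z.im) (v : ι → ℝ) {c : ℝ} (hc : 0 ≤ c) :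
    (realResolvent A z).mulVec (fun i => (v i : ℂ)) =
      (1 - c * ((fun i => (v i : ℂ)) ⬝ᵥ (realResolvent A z).mulVec (fun i => (v i : ℂ)))) •
        (realResolvent (A + c • Matrix.vecMulVec v v) z).mulVec (fun i => (v i : ℂ)) := by
  set w : ι → ℂ := fun i => (v i : ℂ)
  have hB := posSemidef_add_smul_vecMulVec hA v hc
  have h1 : (z • (1 : Matrix ι ι ℂ) - (A + c • Matrix.vecMulVec v v).map Complex.ofReal).mulVec
      ((realResolvent A z).mulVec w) = (1 - c * (w ⬝ᵥ (realResolvent A z).mulVec w)) • w := by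
    rw [map_ofReal_add_smul_vecMulVec, ← sub_sub, Matrix.sub_mulVec, Matrix.mulVec_mulVec,
      shift_mul_realResolvent hA hz, Matrix.one_mulVec, Matrix.smul_mulVec,
      Matrix.vecMulVec_mulVec]
    ext i
    simp [w]
    ring
  have h2 := congrArg (realResolvent (A + c • Matrix.vecMulVec v v) z).mulVec h1
  rwa [Matrix.mulVec_mulVec, realResolvent_mul_shift hB hz, Matrix.one_mulVec,
    Matrix.mulVec_smul] at h2

lemma one_sub_quadratic_ne_zero {A : Matrix ι ι ℝ} (hA : A.PosSemidef) {z : ℂ}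
    (hz : 0 < z.im) (v : ι → ℝ) {c : ℝ} (hc : 0 ≤ c) :
    1 - c * ((fun i => (v i : ℂ)) ⬝ᵥ (realResolvent A z).mulVec (fun i => (v i : ℂ))) ≠ 0 := by
  intro h0
  have h := im_div_norm_le_norm_one_sub hA hz v hc
  have hz0 : 0 < ‖z‖ := norm_pos_iff.2 fun h0 => by simp [h0] at hz
  rw [h0, norm_zero] at h
  exact absurd h (not_le.2 (by positivity))

lemma quadratic_realResolvent_add {A : Matrix ι ι ℝ} (hA : A.PosSemidef) {z : ℂ}
    (hz : 0 < z.im) (v : ι → ℝ) {c : ℝ} (hc : 0 ≤ c) :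
    c * ((fun i => (v i : ℂ)) ⬝ᵥ
      (realResolvent (A + c • Matrix.vecMulVec v v) z).mulVec (fun i => (v i : ℂ))) =
    1 / (1 - c * ((fun i => (v i : ℂ)) ⬝ᵥ
      (realResolvent A z).mulVec (fun i => (v i : ℂ)))) - 1 := by
  have h0 := one_sub_quadratic_ne_zero hA hz v hc
  have h := congrArg (fun u => (c : ℂ) * ((fun i => (v i : ℂ)) ⬝ᵥ u))
    (realResolvent_mulVec_eq_smul hA hz v hc)
  simp only [dotProduct_smul, smul_eq_mul] at h
  field_simp
  linear_combination -h

/-- A rank one update changes the trace of the resolvent by at most `1 / Im z`. -/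
lemma norm_trace_realResolvent_add_sub_le {A : Matrix ι ι ℝ} (hA : A.PosSemidef) {z : ℂ}
    (hz : 0 < z.im) (v : ι → ℝ) {c : ℝ} (hc : 0 ≤ c) :
    ‖(realResolvent (A + c • Matrix.vecMulVec v v) z).trace - (realResolvent A z).trace‖ ≤
      (z.im)⁻¹ := by
  have hB := posSemidef_add_smul_vecMulVec hA v hc
  have h0 := one_sub_quadratic_ne_zero hA hz v hc
  have hSM := realResolvent_mulVec_eq_smul hA hz v hc
  have hlow := im_mul_sum_sq_le_norm_one_sub hA hz v c
  have hl := realResolvent_mul_shift hB hz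
  have hr := shift_mul_realResolvent hA hz
  have ht := realResolvent_transpose hA z
  rw [map_ofReal_add_smul_vecMulVec] at hl
  set w : ι → ℂ := fun i => (v i : ℂ)
  set RA := realResolvent A z
  set RB := realResolvent (A + c • Matrix.vecMulVec v v) z
  set q := 1 - c * (w ⬝ᵥ RA.mulVec w)
  -- Second resolvent identity; symmetry of `RA` turns the row vector wᵀ`RA` into `RA` w.
  have hdiff : RB - RA = (c : ℂ) • Matrix.vecMulVec (RB.mulVec w) (RA.mulVec w) := by
    have e1 : RB - RA = RB * ((z • (1 : Matrix ι ι ℂ) - A.map Complex.ofReal) -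
        (z • (1 : Matrix ι ι ℂ) - (A.map Complex.ofReal + (c : ℂ) • Matrix.vecMulVec w w))) *
          RA := by
      rw [Matrix.mul_sub, Matrix.sub_mul, Matrix.mul_assoc, hr, hl, Matrix.mul_one,
        Matrix.one_mul]
    have e2 : Matrix.vecMul w RA = RA.mulVec w := by
      rw [← Matrix.mulVec_transpose, ht]
    rw [e1, sub_sub_sub_cancel_left, add_sub_cancel_left, Matrix.mul_smul, Matrix.smul_mul,
      Matrix.mul_vecMulVec, Matrix.vecMulVec_mul, e2]
  have htr : q * (RB.trace - RA.trace) = c * (RA.mulVec w ⬝ᵥ RA.mulVec w) := by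
    have e := congrArg (fun u => u ⬝ᵥ RA.mulVec w) hSM
    simp only [smul_dotProduct, smul_eq_mul] at e
    rw [← Matrix.trace_sub, hdiff, Matrix.trace_smul, Matrix.trace_vecMulVec, smul_eq_mul]
    linear_combination -(c : ℂ) * e
  have hn : ‖RA.mulVec w ⬝ᵥ RA.mulVec w‖ ≤ ∑ i, ‖RA.mulVec w i‖ ^ 2 := by
    refine (norm_sum_le _ _).trans (le_of_eq (Finset.sum_congr rfl fun i _ => ?_))
    rw [norm_mul, sq]
  have hq : 0 < ‖q‖ := norm_pos_iff.2 h0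
  have hfin : ‖q‖ * ‖RB.trace - RA.trace‖ ≤ ‖q‖ * (z.im)⁻¹ := by
    rw [← norm_mul, htr, norm_mul, Complex.norm_real, Real.norm_of_nonneg hc,
      ← div_eq_mul_inv, le_div_iff₀ hz]
    calc c * ‖RA.mulVec w ⬝ᵥ RA.mulVec w‖ * z.im
        ≤ c * (∑ i, ‖RA.mulVec w i‖ ^ 2) * z.im := by gcongr
      _ ≤ ‖q‖ := by linarith
  exact le_of_mul_le_mul_left hfin hq

end Resolvent

/-! ### Leave-one-out decomposition of the sample covariance. -/

section SampleCov

variable {ι : Type*} [Fintype ι] {p : ℕ}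

/-- The sample covariance without the `j`-th column. -/
def looCov {ι : Type*} {p : ℕ} (Z : Fin p → ι → ℝ) (j : Fin p) : Matrix ι ι ℝ :=
  (p : ℝ)⁻¹ • ∑ k ∈ Finset.univ.erase j, Matrix.vecMulVec (Z k) (Z k)

lemma looCov_add {ι : Type*} {p : ℕ} (Z : Fin p → ι → ℝ) (j : Fin p) :
    looCov Z j + (p : ℝ)⁻¹ • Matrix.vecMulVec (Z j) (Z j) = sampleCov Z := by
  rw [looCov, sampleCov, ← smul_add, Finset.sum_erase_add _ _ (Finset.mem_univ j)]

lemma looCov_eq_sub {ι : Type*} {p : ℕ} (Z : Fin p → ι → ℝ) (j : Fin p) :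
    sampleCov Z - (p : ℝ)⁻¹ • Matrix.vecMulVec (Z j) (Z j) = looCov Z j := by
  rw [← looCov_add Z j, add_sub_cancel_right]

lemma looCov_congr {ι : Type*} {p : ℕ} {Z Z' : Fin p → ι → ℝ} {j : Fin p}
    (h : ∀ k, k ≠ j → Z k = Z' k) : looCov Z j = looCov Z' j := by
  rw [looCov, looCov]
  congr 1
  exact Finset.sum_congr rfl fun k hk => by rw [h k (Finset.ne_of_mem_erase hk)]

lemma looCov_posSemidef (Z : Fin p → ι → ℝ) (j : Fin p) : (looCov Z j).PosSemidef := by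
  refine Matrix.PosSemidef.smul ?_ (by positivity)
  refine Matrix.posSemidef_sum _ fun k _ => ?_
  simpa using Matrix.posSemidef_vecMulVec_self_star (Z k)

lemma sampleCov_posSemidef (Z : Fin p → ι → ℝ) : (sampleCov Z).PosSemidef := by
  refine Matrix.PosSemidef.smul ?_ (by positivity)
  refine Matrix.posSemidef_sum _ fun k _ => ?_
  simpa using Matrix.posSemidef_vecMulVec_self_star (Z k)

variable [DecidableEq ι]

lemma looResolvent_eq (Z : Fin p → ι → ℝ) (j : Fin p) (z : ℂ) :
    looResolvent Z j z = realResolvent (looCov Z j) z := by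
  rw [looResolvent, looCov_eq_sub]

lemma quadForm_eq (Z : Fin p → ι → ℝ) (j : Fin p) (z : ℂ) :
    quadForm Z j z = ((p : ℝ)⁻¹ : ℝ) * ((fun i => (Z j i : ℂ)) ⬝ᵥ
      (realResolvent (looCov Z j) z).mulVec (fun i => (Z j i : ℂ))) := by
  rw [quadForm, looResolvent_eq]
  simp

lemma one_sub_quadForm_ne_zero (Z : Fin p → ι → ℝ) (j : Fin p) {z : ℂ} (hz : 0 < z.im) :
    1 - quadForm Z j z ≠ 0 := by
  rw [quadForm_eq]
  exact one_sub_quadratic_ne_zero (looCov_posSemidef Z j) hz _ (by positivity)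

lemma norm_one_div_one_sub_quadForm_le (Z : Fin p → ι → ℝ) (j : Fin p) {z : ℂ}
    (hz : 0 < z.im) : ‖1 / (1 - quadForm Z j z)‖ ≤ ‖z‖ / z.im := by
  have h := im_div_norm_le_norm_one_sub (looCov_posSemidef Z j) hz (Z j)
    (c := (p : ℝ)⁻¹) (by positivity)
  rw [← quadForm_eq] at h
  have hz0 : 0 < ‖z‖ := norm_pos_iff.2 fun h0 => by simp [h0] at hz
  rw [norm_div, norm_one, ← one_div_div z.im]
  exact one_div_le_one_div_of_le (by positivity) h

/-- Replacing one column changes the trace of the resolvent by at most `2 / Im z`. -/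
lemma norm_trace_sampleCov_sub_le {Z Z' : Fin p → ι → ℝ} {j : Fin p}
    (h : ∀ k, k ≠ j → Z k = Z' k) {z : ℂ} (hz : 0 < z.im) :
    ‖(realResolvent (sampleCov Z) z).trace - (realResolvent (sampleCov Z') z).trace‖ ≤
      2 * (z.im)⁻¹ := by
  have e : looCov Z j = looCov Z' j := looCov_congr h
  have h1 := norm_trace_realResolvent_add_sub_le (looCov_posSemidef Z j) hz (Z j)
    (c := (p : ℝ)⁻¹) (by positivity)
  have h2 := norm_trace_realResolvent_add_sub_le (looCov_posSemidef Z' j) hz (Z' j)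
    (c := (p : ℝ)⁻¹) (by positivity)
  rw [looCov_add] at h1 h2
  rw [e] at h1
  rw [norm_sub_rev] at h2
  refine (norm_sub_le_norm_sub_add_norm_sub _ (realResolvent (looCov Z' j) z).trace _).trans ?_
  linarith

lemma norm_stieltjesESD_sampleCov_sub_le {Z Z' : Fin p → ι → ℝ} {j : Fin p}
    (h : ∀ k, k ≠ j → Z k = Z' k) {z : ℂ} (hz : 0 < z.im) :
    ‖stieltjesESD (sampleCov Z) z - stieltjesESD (sampleCov Z') z‖ ≤
      2 * (z.im)⁻¹ / Fintype.card ι := by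
  rw [stieltjesESD, stieltjesESD, ← mul_sub, norm_mul, norm_inv, Complex.norm_natCast,
    div_eq_inv_mul]
  gcongr
  exact norm_trace_sampleCov_sub_le h hz

/-- Take the trace of (zI - S)R = I. Each rank one piece of S contributes (1/p) Z_jᵀ R Z_j, which
Sherman–Morrison rewrites through the leave-one-out form. This exact identity becomes the
self-consistent equation. -/
lemma trace_realResolvent_sampleCov (Z : Fin p → ι → ℝ) {z : ℂ} (hz : 0 < z.im) :
    z * (realResolvent (sampleCov Z) z).trace - ∑ j, (1 / (1 - quadForm Z j z) - 1) =
      Fintype.card ι := by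
  have h := congrArg Matrix.trace (shift_mul_realResolvent (sampleCov_posSemidef Z) hz)
  rw [Matrix.sub_mul, Matrix.trace_sub, Matrix.smul_mul, Matrix.one_mul, Matrix.trace_smul,
    smul_eq_mul, Matrix.trace_one] at h
  rw [← h]
  congr 1
  have e : (sampleCov Z).map Complex.ofReal = ((p : ℝ)⁻¹ : ℝ) •
      ∑ j, Matrix.vecMulVec (fun i => (Z j i : ℂ)) (fun i => (Z j i : ℂ)) := by
    ext i k
    simp [sampleCov, Matrix.sum_apply, Matrix.vecMulVec_apply]
  rw [e, Matrix.smul_mul, Matrix.sum_mul, Matrix.trace_smul, Matrix.trace_sum, Finset.smul_sum]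
  refine Finset.sum_congr rfl fun j _ => ?_
  have hq := quadratic_realResolvent_add (looCov_posSemidef Z j) hz (Z j)
    (c := (p : ℝ)⁻¹) (by positivity)
  rw [looCov_add, ← quadForm_eq] at hq
  rw [← hq, Matrix.vecMulVec_mul, Matrix.trace_vecMulVec, ← Matrix.mulVec_transpose,
    realResolvent_transpose (sampleCov_posSemidef Z), Complex.real_smul]

end SampleCov

/-! ### How a fixed set meets a uniformly chosen d-set. -/

section Counting

/-- The ratio of the binomials is the product of (d - i)/(n - i) over i < k, and each factor is at
most d/n because d ≤ n. -/
lemma choose_sub_mul_pow_le {n d : ℕ} (hdn : d ≤ n) {k : ℕ} (hk : k ≤ d) :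
    (n - k).choose (d - k) * n ^ k ≤ n.choose d * d ^ k := by
  induction k with
  | zero => simp
  | succ k ih =>
    obtain ⟨e, rfl⟩ : ∃ e, d = e + (k + 1) := ⟨d - (k + 1), by omega⟩
    obtain ⟨m, rfl⟩ : ∃ m, n = m + (k + 1) := ⟨n - (k + 1), by omega⟩
    have ih := ih (by omega)
    have h1 := Nat.add_one_mul_choose_eq m e
    rw [show m + (k + 1) - k = m + 1 by omega, show e + (k + 1) - k = e + 1 by omega] at ih
    rw [Nat.add_sub_cancel, Nat.add_sub_cancel]
    have h2 : m.choose e * (m + (k + 1)) ≤ (m + 1).choose (e + 1) * (e + (k + 1)) := by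
      refine Nat.le_of_mul_le_mul_left ?_ (Nat.add_one_pos m)
      calc (m + 1) * (m.choose e * (m + (k + 1)))
          = (m + 1).choose (e + 1) * ((e + 1) * (m + (k + 1))) := by
            rw [← mul_assoc, h1, mul_assoc]
        _ ≤ (m + 1).choose (e + 1) * ((m + 1) * (e + (k + 1))) := by
            refine Nat.mul_le_mul_left _ ?_
            nlinarith
        _ = _ := by ring
    calc m.choose e * (m + (k + 1)) ^ (k + 1)
        = m.choose e * (m + (k + 1)) * (m + (k + 1)) ^ k := by ring
      _ ≤ (m + 1).choose (e + 1) * (e + (k + 1)) * (m + (k + 1)) ^ k := by gcongr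
      _ = (m + 1).choose (e + 1) * (m + (k + 1)) ^ k * (e + (k + 1)) := by ring
      _ ≤ (m + (k + 1)).choose (e + (k + 1)) * (e + (k + 1)) ^ k * (e + (k + 1)) := by gcongr
      _ = _ := by ring

lemma card_row (n d : ℕ) : Fintype.card (Row n d) = n.choose d := by
  rw [Fintype.card_finset_len, Fintype.card_fin]

lemma sum_row_eq {n d : ℕ} (f : Finset (Fin n) → ℝ) :
    ∑ u : Row n d, f u.1 = ∑ u ∈ Finset.powersetCard d Finset.univ, f u := by
  refine (Finset.sum_subtype _ (fun u => ?_) f).symm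
  simp

lemma card_row_superset_le {n d : ℕ} (hdn : d ≤ n) (hn : 0 < n) (b : Finset (Fin n)) :
    ∑ u : Row n d, (if b ⊆ u.1 then (1 : ℝ) else 0) ≤ n.choose d * (d / n : ℝ) ^ b.card := by
  rw [sum_row_eq fun u => if b ⊆ u then (1 : ℝ) else 0, Finset.sum_boole]
  by_cases hb : b.card ≤ d
  · rw [Finset.card_filter_powersetCard_subset _ _ _ (Finset.subset_univ b) hb,
      Finset.card_univ, Fintype.card_fin, div_pow, mul_div_assoc', le_div_iff₀ (by positivity)]
    exact_mod_cast choose_sub_mul_pow_le hdn hb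
  · rw [Finset.filter_eq_empty_iff.2]
    · simp only [Finset.card_empty, Nat.cast_zero]
      positivity
    · intro u hu h
      rw [Finset.mem_powersetCard_univ] at hu
      exact hb (hu ▸ Finset.card_le_card h)

/-- The moment generating function of the size of the intersection of a fixed set with a uniformly
chosen `d`-set. -/
lemma sum_row_pow_card_inter_le {n d : ℕ} (hdn : d ≤ n) (hn : 0 < n) (a : Finset (Fin n))
    {L : ℝ} (hL : 0 ≤ L) :
    ∑ u : Row n d, (1 + L) ^ (a ∩ u.1).card ≤
      n.choose d * Real.exp (a.card * (L * (d / n))) := by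
  -- Expand the power over subsets b of a ∩ u. After exchanging sums, each b needs only the number
  -- of d-sets containing it.
  have h1 : ∀ u : Row n d, (1 + L) ^ (a ∩ u.1).card =
      ∑ b ∈ a.powerset, L ^ b.card * (if b ⊆ u.1 then (1 : ℝ) else 0) := by
    intro u
    rw [← Finset.prod_const, Finset.prod_one_add]
    simp only [mul_ite, mul_one, mul_zero]
    rw [← Finset.sum_filter]
    refine Finset.sum_congr ?_ fun b _ => by simp
    ext b
    simp only [Finset.mem_powerset, Finset.mem_filter, Finset.subset_inter_iff]
  simp_rw [h1]
  rw [Finset.sum_comm]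
  calc ∑ b ∈ a.powerset, ∑ u : Row n d, L ^ b.card * (if b ⊆ u.1 then (1 : ℝ) else 0)
      ≤ ∑ b ∈ a.powerset, n.choose d * ∏ _i ∈ b, (L * (d / n : ℝ)) := by
        refine Finset.sum_le_sum fun b _ => ?_
        rw [← Finset.mul_sum, Finset.prod_const, mul_pow]
        have := card_row_superset_le hdn hn b
        calc _ ≤ L ^ b.card * (n.choose d * (d / n : ℝ) ^ b.card) := by gcongr
          _ = _ := by ring
    _ = n.choose d * (1 + L * (d / n)) ^ a.card := by
        rw [← Finset.mul_sum, ← Finset.prod_one_add, Finset.prod_const]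
    _ ≤ _ := by
        rw [Real.exp_nat_mul]
        gcongr
        rw [add_comm]
        exact Real.add_one_le_exp _

end Counting

/-! ### Covariances of products of tensor coordinates. -/

section Moments

/-- The facts about the first four moments of the entries that enter the proof. -/
structure MomentBound (ν : Measure ℝ) (L : ℝ) : Prop where
  one_le : 1 ≤ L
  integrable : ∀ k ≤ 4, Integrable (fun t : ℝ => t ^ k) ν
  first : ∫ t, t ^ 1 ∂ν = 0
  second : ∫ t, t ^ 2 ∂ν = 1
  third : ∫ t, t ^ 3 ∂ν = 0
  one_le_fourth : 1 ≤ ∫ t, t ^ 4 ∂ν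
  fourth_le : ∫ t, t ^ 4 ∂ν ≤ 1 + L

/-- The number of the four sets that contain `i`. -/
def multiplicity {α : Type*} [DecidableEq α] (s t u v : Finset α) (i : α) : ℕ :=
  (if i ∈ s then 1 else 0) + (if i ∈ t then 1 else 0) + (if i ∈ u then 1 else 0) +
    (if i ∈ v then 1 else 0)

lemma multiplicity_le {α : Type*} [DecidableEq α] (s t u v : Finset α) (i : α) :
    multiplicity s t u v i ≤ 4 := by
  unfold multiplicity
  split_ifs <;> simp

lemma prod_four_eq {n : ℕ} (s t u v : Finset (Fin n)) (x : Fin n → ℝ) :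
    (∏ i ∈ s, x i) * (∏ i ∈ t, x i) * ((∏ i ∈ u, x i) * ∏ i ∈ v, x i) =
      ∏ i, x i ^ multiplicity s t u v i := by
  have h : ∀ w : Finset (Fin n), ∏ i ∈ w, x i = ∏ i, x i ^ (if i ∈ w then 1 else 0) := by
    intro w
    simp only [pow_ite, pow_one, pow_zero]
    rw [Finset.prod_ite_mem, Finset.univ_inter]
  simp only [multiplicity, pow_add, Finset.prod_mul_distrib]
  rw [← h, ← h, ← h, ← h]
  ring

variable {ν : Measure ℝ} [IsProbabilityMeasure ν] {L : ℝ} {n : ℕ}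

lemma integrable_prod_four (hν : MomentBound ν L) (s t u v : Finset (Fin n)) :
    Integrable (fun x : Fin n → ℝ =>
      (∏ i ∈ s, x i) * (∏ i ∈ t, x i) * ((∏ i ∈ u, x i) * ∏ i ∈ v, x i))
      (Measure.pi fun _ => ν) := by
  simp_rw [prod_four_eq]
  exact Integrable.fintype_prod (f := fun i (y : ℝ) => y ^ multiplicity s t u v i)
    fun i => hν.integrable _ (multiplicity_le _ _ _ _ i)

lemma integral_prod_four (s t u v : Finset (Fin n)) :
    ∫ x : Fin n → ℝ, (∏ i ∈ s, x i) * (∏ i ∈ t, x i) * ((∏ i ∈ u, x i) * ∏ i ∈ v, x i)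
      ∂(Measure.pi fun _ => ν) = ∏ i, ∫ x, x ^ multiplicity s t u v i ∂ν := by
  simp_rw [prod_four_eq]
  exact integral_fintype_prod_eq_prod (fun i (y : ℝ) => y ^ multiplicity s t u v i)

/-- An index in exactly one of the two symmetric differences lies in one or three of the four sets,
so its factor is an odd moment. -/
lemma integral_prod_four_eq_zero (hν : MomentBound ν L) {s t u v : Finset (Fin n)}
    (h : symmDiff s t ≠ symmDiff u v) :
    ∫ x : Fin n → ℝ, (∏ i ∈ s, x i) * (∏ i ∈ t, x i) * ((∏ i ∈ u, x i) * ∏ i ∈ v, x i)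
      ∂(Measure.pi fun _ => ν) = 0 := by
  rw [integral_prod_four]
  obtain ⟨i, hi⟩ : ∃ i, ¬ (i ∈ symmDiff s t ↔ i ∈ symmDiff u v) := by
    by_contra! hcon
    exact h (Finset.ext hcon)
  refine Finset.prod_eq_zero (Finset.mem_univ i) ?_
  have hm : multiplicity s t u v i = 1 ∨ multiplicity s t u v i = 3 := by
    simp only [Finset.mem_symmDiff] at hi
    unfold multiplicity
    by_cases h1 : i ∈ s <;> by_cases h2 : i ∈ t <;> by_cases h3 : i ∈ u <;>
      by_cases h4 : i ∈ v <;> simp_all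
  rcases hm with h | h
  · rw [h, hν.first]
  · rw [h, hν.third]

/-- All multiplicities are now even. Those equal to 0 or 2 contribute 1; only indices common to all
four sets contribute a fourth moment. -/
lemma integral_prod_four_mem (hν : MomentBound ν L) {s t u v : Finset (Fin n)}
    (h : symmDiff s t = symmDiff u v) :
    1 ≤ ∫ x : Fin n → ℝ, (∏ i ∈ s, x i) * (∏ i ∈ t, x i) * ((∏ i ∈ u, x i) * ∏ i ∈ v, x i)
      ∂(Measure.pi fun _ => ν) ∧
    ∫ x : Fin n → ℝ, (∏ i ∈ s, x i) * (∏ i ∈ t, x i) * ((∏ i ∈ u, x i) * ∏ i ∈ v, x i)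
      ∂(Measure.pi fun _ => ν) ≤ (1 + L) ^ (s ∩ t ∩ u ∩ v).card := by
  rw [integral_prod_four]
  have hfac : ∀ i, 1 ≤ ∫ x, x ^ multiplicity s t u v i ∂ν ∧
      ∫ x, x ^ multiplicity s t u v i ∂ν ≤ if i ∈ s ∩ t ∩ u ∩ v then 1 + L else 1 := by
    intro i
    have hm : (multiplicity s t u v i = 0 ∨ multiplicity s t u v i = 2) ∧
        i ∉ s ∩ t ∩ u ∩ v ∨ multiplicity s t u v i = 4 ∧ i ∈ s ∩ t ∩ u ∩ v := by
      have hi := Finset.ext_iff.1 h i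
      simp only [Finset.mem_symmDiff] at hi
      unfold multiplicity
      by_cases h1 : i ∈ s <;> by_cases h2 : i ∈ t <;> by_cases h3 : i ∈ u <;>
        by_cases h4 : i ∈ v <;> simp_all
    rcases hm with ⟨h0 | h0, hi⟩ | ⟨h0, hi⟩
    · rw [if_neg hi, h0]
      simp
    · rw [if_neg hi, h0, hν.second]
      exact ⟨le_rfl, le_rfl⟩
    · rw [h0, if_pos hi]
      exact ⟨hν.one_le_fourth, hν.fourth_le⟩
  constructor
  · calc (1 : ℝ) = ∏ _i : Fin n, (1 : ℝ) := by simp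
      _ ≤ _ := Finset.prod_le_prod (fun _ _ => zero_le_one) fun i _ => (hfac i).1
  · refine (Finset.prod_le_prod (fun i _ => zero_le_one.trans (hfac i).1)
      fun i _ => (hfac i).2).trans (le_of_eq ?_)
    rw [Finset.prod_ite_mem, Finset.univ_inter, Finset.prod_const]

lemma integral_prod_two (hν : MomentBound ν L) (s t : Finset (Fin n)) :
    ∫ x : Fin n → ℝ, (∏ i ∈ s, x i) * (∏ i ∈ t, x i) ∂(Measure.pi fun _ => ν) =
      if s = t then 1 else 0 := by
  have e : ∫ x : Fin n → ℝ, (∏ i ∈ s, x i) * (∏ i ∈ t, x i) ∂(Measure.pi fun _ => ν) =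
      ∫ x : Fin n → ℝ, (∏ i ∈ s, x i) * (∏ i ∈ t, x i) *
        ((∏ i ∈ (∅ : Finset (Fin n)), x i) * ∏ i ∈ (∅ : Finset (Fin n)), x i)
      ∂(Measure.pi fun _ => ν) := by simp
  rw [e]
  split_ifs with h
  · have := integral_prod_four_mem hν (s := s) (t := t) (u := ∅) (v := ∅) (by simp [h])
    rw [Finset.inter_empty, Finset.card_empty, pow_zero] at this
    exact le_antisymm this.2 this.1
  · exact integral_prod_four_eq_zero hν (by simpa using h)

lemma integrable_prod_two (hν : MomentBound ν L) (s t : Finset (Fin n)) :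
    Integrable (fun x : Fin n → ℝ => (∏ i ∈ s, x i) * (∏ i ∈ t, x i))
      (Measure.pi fun _ => ν) := by
  simpa using integrable_prod_four hν s t ∅ ∅

variable {d : ℕ}

/-- The centred products `Z_s Z_t - 𝔼[Z_s Z_t]`. -/
def centredProd (x : Fin n → ℝ) (a : Row n d × Row n d) : ℝ :=
  (∏ i ∈ a.1.1, x i) * (∏ i ∈ a.2.1, x i) - if a.1 = a.2 then 1 else 0

lemma centredProd_mul (x : Fin n → ℝ) (a b : Row n d × Row n d) :
    centredProd x a * centredProd x b =
      (∏ i ∈ a.1.1, x i) * (∏ i ∈ a.2.1, x i) * ((∏ i ∈ b.1.1, x i) * ∏ i ∈ b.2.1, x i) -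
      (if b.1 = b.2 then 1 else 0) * ((∏ i ∈ a.1.1, x i) * (∏ i ∈ a.2.1, x i)) -
      (if a.1 = a.2 then 1 else 0) * ((∏ i ∈ b.1.1, x i) * (∏ i ∈ b.2.1, x i)) +
      (if a.1 = a.2 then 1 else 0) * (if b.1 = b.2 then 1 else 0) := by
  unfold centredProd
  ring

lemma integrable_centredProd_mul (hν : MomentBound ν L) (a b : Row n d × Row n d) :
    Integrable (fun x : Fin n → ℝ => centredProd x a * centredProd x b)
      (Measure.pi fun _ => ν) := by
  simp_rw [centredProd_mul]
  exact (((integrable_prod_four hν _ _ _ _).sub ((integrable_prod_two hν _ _).const_mul _)).sub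
    ((integrable_prod_two hν _ _).const_mul _)).add (integrable_const _)

lemma integral_centredProd_mul (hν : MomentBound ν L) (a b : Row n d × Row n d) :
    ∫ x : Fin n → ℝ, centredProd x a * centredProd x b ∂(Measure.pi fun _ => ν) =
      (∫ x : Fin n → ℝ, (∏ i ∈ a.1.1, x i) * (∏ i ∈ a.2.1, x i) *
        ((∏ i ∈ b.1.1, x i) * ∏ i ∈ b.2.1, x i) ∂(Measure.pi fun _ => ν)) -
      (if a.1 = a.2 then 1 else 0) * (if b.1 = b.2 then 1 else 0) := by
  have key : ∀ (f g h : (Fin n → ℝ) → ℝ) (c₁ c₂ c₃ : ℝ),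
      Integrable f (Measure.pi fun _ => ν) → Integrable g (Measure.pi fun _ => ν) →
      Integrable h (Measure.pi fun _ => ν) →
      ∫ x, (f x - c₁ * g x - c₂ * h x + c₃) ∂(Measure.pi fun _ => ν) =
        (∫ x, f x ∂(Measure.pi fun _ => ν)) - c₁ * (∫ x, g x ∂(Measure.pi fun _ => ν)) -
          c₂ * (∫ x, h x ∂(Measure.pi fun _ => ν)) + c₃ := by
    intro f g h c₁ c₂ c₃ hf hg hh
    have hg' := hg.const_mul c₁
    have hh' := hh.const_mul c₂
    have hfg : Integrable (fun x => f x - c₁ * g x) (Measure.pi fun _ => ν) := hf.sub hg'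
    have hfgh : Integrable (fun x => f x - c₁ * g x - c₂ * h x) (Measure.pi fun _ => ν) :=
      hfg.sub hh'
    rw [integral_add hfgh (integrable_const _), integral_sub hfg hh', integral_sub hf hg',
      integral_const_mul, integral_const_mul, integral_const, probReal_univ, one_smul]
  simp_rw [centredProd_mul]
  rw [key _ _ _ _ _ _ (integrable_prod_four hν _ _ _ _) (integrable_prod_two hν _ _)
    (integrable_prod_two hν _ _), integral_prod_two hν, integral_prod_two hν]
  simp only [Subtype.ext_iff]
  ring

/-- Given the pair (s, t) and u, at most one v gives a nonzero covariance. The -1 on the right is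
what makes the sum small. When s = t it comes from the centring. When s ≠ t nothing is subtracted,
but the fourfold intersection is strictly smaller than (s ∪ t) ∩ u, and the spare factor 1 + L ≥ 2
pays for it. -/
lemma abs_integral_centredProd_mul_le (hν : MomentBound ν L) (a b : Row n d × Row n d) :
    |∫ x : Fin n → ℝ, centredProd x a * centredProd x b ∂(Measure.pi fun _ => ν)| ≤
      if b.2.1 = symmDiff b.1.1 (symmDiff a.1.1 a.2.1) then
        (1 + L) ^ ((a.1.1 ∪ a.2.1) ∩ b.1.1).card - 1 else 0 := by
  have hL := hν.one_le
  rw [integral_centredProd_mul hν]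
  obtain ⟨⟨s, hs⟩, ⟨t, ht⟩⟩ := a
  obtain ⟨⟨u, hu⟩, ⟨v, hv⟩⟩ := b
  simp only [Subtype.mk.injEq]
  have hiff : v = symmDiff u (symmDiff s t) ↔ symmDiff s t = symmDiff u v := by
    constructor
    · rintro rfl
      rw [symmDiff_symmDiff_cancel_left]
    · intro h
      rw [h, symmDiff_symmDiff_cancel_left]
  by_cases h : symmDiff s t = symmDiff u v
  · rw [if_pos (hiff.2 h)]
    obtain ⟨h1, h2⟩ := integral_prod_four_mem hν h
    by_cases hst : s = t
    · have huv : u = v := by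
        rw [hst, symmDiff_self] at h
        exact symmDiff_eq_bot.1 h.symm
      subst hst huv
      rw [if_pos rfl, if_pos rfl, mul_one, abs_of_nonneg (by linarith)]
      rw [Finset.inter_self, Finset.inter_assoc, Finset.inter_self] at h2
      rw [Finset.union_self]
      linarith
    · rw [if_neg hst, zero_mul, sub_zero, abs_of_nonneg (by linarith)]
      have huv : u ≠ v := by
        rintro rfl
        rw [symmDiff_self] at h
        exact hst (symmDiff_eq_bot.1 h)
      -- Since u and v have the same size, u ≠ v provides an element of u outside v; it witnesses
      -- the strict inclusion.
      obtain ⟨i, hiu, hiv⟩ : ∃ i ∈ u, i ∉ v := by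
        by_contra! hcon
        exact huv (Finset.eq_of_subset_of_card_le hcon (by omega))
      have hi : i ∈ s ∪ t := by
        have : i ∈ symmDiff s t := by
          rw [h, Finset.mem_symmDiff]
          exact Or.inl ⟨hiu, hiv⟩
        rw [Finset.mem_symmDiff] at this
        rw [Finset.mem_union]
        tauto
      have hlt : (s ∩ t ∩ u ∩ v).card < ((s ∪ t) ∩ u).card := by
        refine Finset.card_lt_card ⟨fun j hj => ?_, fun hsub => ?_⟩
        · simp only [Finset.mem_inter, Finset.mem_union] at hj ⊢
          tauto
        · have := hsub (Finset.mem_inter.2 ⟨hi, hiu⟩)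
          exact hiv (Finset.mem_inter.1 this).2
      have h3 : (1 + L) ^ ((s ∩ t ∩ u ∩ v).card + 1) ≤ (1 + L) ^ ((s ∪ t) ∩ u).card :=
        pow_le_pow_right₀ (by linarith) hlt
      have h4 : 1 ≤ (1 + L) ^ (s ∩ t ∩ u ∩ v).card := one_le_pow₀ (by linarith)
      rw [pow_succ] at h3
      nlinarith
  · rw [if_neg (fun h' => h (hiff.1 h')), integral_prod_four_eq_zero hν h]
    have : ¬ (s = t ∧ u = v) := by
      rintro ⟨rfl, rfl⟩
      simp at h
    by_cases hst : s = t
    · have huv : u ≠ v := fun h => this ⟨hst, h⟩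
      simp [huv]
    · simp [hst]

/-- Each u has at most one partner v, so the double sum collapses to the moment generating function
of the intersection of u with s ∪ t, a set of at most 2d elements. -/
lemma sum_abs_integral_centredProd_mul_le (hν : MomentBound ν L) (hdn : d ≤ n) (hn : 0 < n)
    (a : Row n d × Row n d) :
    ∑ b : Row n d × Row n d, |∫ x : Fin n → ℝ, centredProd x a * centredProd x b ∂(Measure.pi fun _ => ν)| ≤
      n.choose d * (Real.exp (2 * d * (L * (d / n))) - 1) := by
  have hL := hν.one_le
  calc ∑ b : Row n d × Row n d,
        |∫ x : Fin n → ℝ, centredProd x a * centredProd x b ∂(Measure.pi fun _ => ν)|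
      ≤ ∑ u : Row n d, ∑ v : Row n d, if v.1 = symmDiff u.1 (symmDiff a.1.1 a.2.1) then
        (1 + L) ^ ((a.1.1 ∪ a.2.1) ∩ u.1).card - 1 else 0 := by
        rw [Fintype.sum_prod_type]
        exact Finset.sum_le_sum fun u _ => Finset.sum_le_sum fun v _ =>
          abs_integral_centredProd_mul_le hν a (u, v)
    _ ≤ ∑ u : Row n d, ((1 + L) ^ ((a.1.1 ∪ a.2.1) ∩ u.1).card - 1) := by
        refine Finset.sum_le_sum fun u _ => ?_
        have h0 : 0 ≤ (1 + L) ^ ((a.1.1 ∪ a.2.1) ∩ u.1).card - 1 :=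
          sub_nonneg.2 (one_le_pow₀ (by linarith))
        by_cases hw : (symmDiff u.1 (symmDiff a.1.1 a.2.1)).card = d
        · rw [Finset.sum_eq_single (⟨_, hw⟩ : Row n d)]
          · rw [if_pos rfl]
          · intro v _ hv
            exact if_neg fun h => hv (Subtype.ext h)
          · simp
        · rw [Finset.sum_eq_zero]
          · exact h0
          · intro v _
            refine if_neg fun h => hw ?_
            rw [← h]
            exact v.2
    _ ≤ n.choose d * Real.exp ((a.1.1 ∪ a.2.1).card * (L * (d / n))) - n.choose d := by
        rw [Finset.sum_sub_distrib]
        have := sum_row_pow_card_inter_le hdn hn (a.1.1 ∪ a.2.1) (by linarith : 0 ≤ L)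
        simp only [Finset.sum_const, Finset.card_univ, card_row, nsmul_eq_mul, mul_one]
        linarith
    _ ≤ n.choose d * Real.exp (2 * d * (L * (d / n))) - n.choose d := by
        gcongr
        have := Finset.card_union_le a.1.1 a.2.1
        rw [a.1.2, a.2.2] at this
        have h2 : ((a.1.1 ∪ a.2.1).card : ℝ) ≤ d + d := by exact_mod_cast this
        linarith
    _ = _ := by ring

end Moments

/-! ### Concentration of quadratic forms around the trace. -/

section QuadraticForm

/-- A second moment bound for linear combinations, from the row sums of the covariance matrix. -/
lemma integral_norm_sq_sum_le {Ω κ : Type*} [MeasurableSpace Ω] {μ : Measure Ω} [Fintype κ]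
    (Y : Ω → κ → ℝ) (A : κ → ℂ) {M : ℝ}
    (hint : ∀ a b, Integrable (fun ω => Y ω a * Y ω b) μ)
    (hrow : ∀ a, ∑ b, |∫ ω, Y ω a * Y ω b ∂μ| ≤ M) :
    Integrable (fun ω => ‖∑ a, A a * Y ω a‖ ^ 2) μ ∧
    ∫ ω, ‖∑ a, A a * Y ω a‖ ^ 2 ∂μ ≤ M * ∑ a, ‖A a‖ ^ 2 := by
  have hexp : ∀ ω, ‖∑ a, A a * Y ω a‖ ^ 2 =
      ∑ a, ∑ b, (A a * star (A b)).re * (Y ω a * Y ω b) := by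
    intro ω
    have h : ((‖∑ a, A a * Y ω a‖ ^ 2 : ℝ) : ℂ) =
        ∑ a, ∑ b, (A a * star (A b)) * ((Y ω a * Y ω b : ℝ) : ℂ) := by
      rw [Complex.ofReal_pow, ← Complex.mul_conj', map_sum, Finset.sum_mul_sum]
      refine Finset.sum_congr rfl fun a _ => Finset.sum_congr rfl fun b _ => ?_
      simp
      ring
    have h' := congrArg Complex.re h
    simpa only [Complex.ofReal_re, Complex.re_sum, Complex.re_mul_ofReal] using h'
  simp_rw [hexp]
  have hint' : ∀ a b, Integrable (fun ω => (A a * star (A b)).re * (Y ω a * Y ω b)) μ :=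
    fun a b => (hint a b).const_mul _
  refine ⟨integrable_finsetSum _ fun a _ => integrable_finsetSum _ fun b _ => hint' a b, ?_⟩
  rw [integral_finsetSum _ fun a _ => integrable_finsetSum _ fun b _ => hint' a b]
  simp_rw [integral_finsetSum _ fun b _ => hint' _ b, integral_const_mul]
  -- Schur test: 2‖A a‖‖A b‖ ≤ ‖A a‖² + ‖A b‖², and symmetry of the covariances turns both halves
  -- into row sums.
  set c : κ → κ → ℝ := fun a b => |∫ ω, Y ω a * Y ω b ∂μ| with hc
  have hsymm : ∀ a b, c a b = c b a := fun a b => by simp only [hc, mul_comm]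
  calc ∑ a, ∑ b, (A a * star (A b)).re * ∫ ω, Y ω a * Y ω b ∂μ
      ≤ ∑ a, ∑ b, (‖A a‖ ^ 2 * c a b / 2 + ‖A b‖ ^ 2 * c a b / 2) := by
        refine Finset.sum_le_sum fun a _ => Finset.sum_le_sum fun b _ => ?_
        have h1 : |(A a * star (A b)).re| ≤ ‖A a‖ * ‖A b‖ := by
          refine (Complex.abs_re_le_norm _).trans ?_
          rw [norm_mul, norm_star]
        have h2 : (A a * star (A b)).re * ∫ ω, Y ω a * Y ω b ∂μ ≤ ‖A a‖ * ‖A b‖ * c a b := by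
          refine (le_abs_self _).trans ?_
          rw [abs_mul]
          gcongr
        have h3 : 0 ≤ c a b := abs_nonneg _
        nlinarith [mul_nonneg h3 (sq_nonneg (‖A a‖ - ‖A b‖))]
    _ = ∑ a, ‖A a‖ ^ 2 * ∑ b, c a b := by
        simp_rw [Finset.sum_add_distrib]
        have : ∑ a, ∑ b, ‖A b‖ ^ 2 * c a b / 2 = ∑ a, ∑ b, ‖A a‖ ^ 2 * c a b / 2 := by
          rw [Finset.sum_comm]
          exact Finset.sum_congr rfl fun a _ => Finset.sum_congr rfl fun b _ => by rw [hsymm]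
        rw [this, ← Finset.sum_add_distrib]
        refine Finset.sum_congr rfl fun a _ => ?_
        rw [← Finset.sum_add_distrib, Finset.mul_sum]
        exact Finset.sum_congr rfl fun b _ => by ring
    _ ≤ ∑ a, ‖A a‖ ^ 2 * M := by
        gcongr with a
        exact hrow a
    _ = _ := by rw [← Finset.sum_mul, mul_comm]

variable {ν : Measure ℝ} [IsProbabilityMeasure ν] {L : ℝ} {n d : ℕ}

lemma quadratic_sub_trace_eq (A : Matrix (Row n d) (Row n d) ℂ) (x : Fin n → ℝ) :
    (fun i => (tensorVec n d x i : ℂ)) ⬝ᵥ A.mulVec (fun i => (tensorVec n d x i : ℂ)) - A.trace =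
      ∑ a : Row n d × Row n d, A a.1 a.2 * (centredProd x a : ℂ) := by
  rw [Fintype.sum_prod_type]
  have h : A.trace = ∑ s, ∑ t, A s t * (if s = t then 1 else 0) := by
    simp [Matrix.trace]
  rw [h]
  simp only [dotProduct, Matrix.mulVec, Finset.mul_sum, ← Finset.sum_sub_distrib]
  refine Finset.sum_congr rfl fun s _ => Finset.sum_congr rfl fun t _ => ?_
  simp only [centredProd, tensorVec]
  push_cast
  split_ifs <;> simp <;> ring

lemma measurable_tensorVec (n d : ℕ) : Measurable (tensorVec n d) := by
  unfold tensorVec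
  fun_prop

instance (n d : ℕ) : IsProbabilityMeasure (tensorLaw n d ν) :=
  Measure.isProbabilityMeasure_map (measurable_tensorVec n d).aemeasurable

/-- Concentration of quadratic forms of a random tensor about the trace. -/
lemma integral_norm_sq_quadratic_sub_trace_le (hν : MomentBound ν L) (hdn : d ≤ n) (hn : 0 < n)
    (A : Matrix (Row n d) (Row n d) ℂ) {K : ℝ} (hA : ∀ t, ∑ s, ‖A s t‖ ^ 2 ≤ K) :
    Integrable (fun y : Row n d → ℝ =>
      ‖(fun i => (y i : ℂ)) ⬝ᵥ A.mulVec (fun i => (y i : ℂ)) - A.trace‖ ^ 2) (tensorLaw n d ν) ∧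
    ∫ y, ‖(fun i => (y i : ℂ)) ⬝ᵥ A.mulVec (fun i => (y i : ℂ)) - A.trace‖ ^ 2
      ∂(tensorLaw n d ν) ≤
      (n.choose d : ℝ) ^ 2 * K * (Real.exp (2 * d * (L * (d / n))) - 1) := by
  have hL := hν.one_le
  have hmeas : Measurable (fun y : Row n d → ℝ =>
      ‖(fun i => (y i : ℂ)) ⬝ᵥ A.mulVec (fun i => (y i : ℂ)) - A.trace‖ ^ 2) := by
    unfold dotProduct Matrix.mulVec dotProduct
    fun_prop
  obtain ⟨h1, h2⟩ := integral_norm_sq_sum_le (μ := Measure.pi fun _ : Fin n => ν)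
    (fun x a => centredProd x a)
    (fun a : Row n d × Row n d => A a.1 a.2) (integrable_centredProd_mul hν)
    (sum_abs_integral_centredProd_mul_le hν hdn hn)
  simp_rw [← quadratic_sub_trace_eq] at h1 h2
  rw [tensorLaw]
  refine ⟨(integrable_map_measure hmeas.aestronglyMeasurable
    (measurable_tensorVec n d).aemeasurable).2 h1, ?_⟩
  rw [integral_map (measurable_tensorVec n d).aemeasurable hmeas.aestronglyMeasurable]
  refine h2.trans ?_
  have h3 : ∑ a : Row n d × Row n d, ‖A a.1 a.2‖ ^ 2 ≤ n.choose d * K := by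
    rw [Fintype.sum_prod_type_right]
    refine (Finset.sum_le_sum fun t _ => hA t).trans ?_
    simp
  have h4 : 0 ≤ Real.exp (2 * d * (L * (d / n))) - 1 :=
    sub_nonneg.2 (Real.one_le_exp (by positivity))
  calc _ ≤ (n.choose d * (Real.exp (2 * d * (L * (d / n))) - 1)) * (n.choose d * K) := by gcongr
    _ = _ := by ring

end QuadraticForm

/-! ### Variance bounds, Fubini and exchangeability on product spaces. -/

section ProductMeasure

lemma sq_integral_le {Ω : Type*} [MeasurableSpace Ω] {μ : Measure Ω} [IsProbabilityMeasure μ]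
    {g : Ω → ℝ} (hg : Integrable g μ) (hg2 : Integrable (fun ω => g ω ^ 2) μ) :
    (∫ ω, g ω ∂μ) ^ 2 ≤ ∫ ω, g ω ^ 2 ∂μ := by
  set m := ∫ ω, g ω ∂μ with hm
  have h1 : Integrable (fun ω => 2 * m * g ω) μ := hg.const_mul _
  have h2 : Integrable (fun ω => g ω ^ 2 - 2 * m * g ω) μ := hg2.sub h1
  have h : 0 ≤ ∫ ω, (g ω ^ 2 - 2 * m * g ω + m ^ 2) ∂μ :=
    integral_nonneg fun ω => by
      have := sq_nonneg (g ω - m)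
      simp only [Pi.zero_apply]
      linarith
  rw [integral_add h2 (integrable_const _), integral_sub hg2 h1, integral_const_mul,
    integral_const, probReal_univ, one_smul, ← hm] at h
  linarith

lemma integral_le_sqrt_integral_sq {Ω : Type*} [MeasurableSpace Ω] {μ : Measure Ω}
    [IsProbabilityMeasure μ] {g : Ω → ℝ} (hg : Integrable g μ)
    (hg2 : Integrable (fun ω => g ω ^ 2) μ) : ∫ ω, g ω ∂μ ≤ √(∫ ω, g ω ^ 2 ∂μ) :=
  Real.le_sqrt_of_sq_le (sq_integral_le hg hg2)

lemma integrable_of_measurable_bounded {Ω F : Type*} [MeasurableSpace Ω] {μ : Measure Ω}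
    [IsFiniteMeasure μ] [NormedAddCommGroup F] [MeasurableSpace F] [BorelSpace F]
    [SecondCountableTopology F] {f : Ω → F} (hf : Measurable f) {B : ℝ} (hB : ∀ ω, ‖f ω‖ ≤ B) :
    Integrable f μ :=
  Integrable.of_bound hf.aestronglyMeasurable B (ae_of_all _ hB)

/-- A function that varies by at most `c` has variance at most `c ^ 2`. -/
lemma integral_sq_sub_sq_le {E : Type*} [MeasurableSpace E] {μ : Measure E}
    [IsProbabilityMeasure μ] {h : E → ℝ} (hm : Measurable h) {c : ℝ}
    (hc : ∀ a b, |h a - h b| ≤ c) : ∫ a, h a ^ 2 ∂μ - (∫ a, h a ∂μ) ^ 2 ≤ c ^ 2 := by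
  obtain ⟨a₀⟩ : Nonempty E := nonempty_of_isProbabilityMeasure μ
  set t := h a₀
  have hbd : ∀ a, |h a| ≤ |t| + c := fun a => by
    have := abs_sub_abs_le_abs_sub (h a) t
    linarith [hc a a₀]
  have h1 : Integrable h μ := integrable_of_measurable_bounded hm hbd
  have h2 : Integrable (fun a => h a ^ 2) μ := by
    refine integrable_of_measurable_bounded (hm.pow_const 2) (B := (|t| + c) ^ 2) fun a => ?_
    rw [norm_pow]
    exact pow_le_pow_left₀ (norm_nonneg _) (hbd a) 2
  have h3 : Integrable (fun a => 2 * t * h a) μ := h1.const_mul _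
  have h4 : Integrable (fun a => h a ^ 2 - 2 * t * h a) μ := h2.sub h3
  have hle : ∫ a, (h a ^ 2 - 2 * t * h a + t ^ 2) ∂μ ≤ ∫ _a, c ^ 2 ∂μ := by
    refine integral_mono (h4.add (integrable_const _)) (integrable_const _) fun a => ?_
    have := pow_le_pow_left₀ (abs_nonneg _) (hc a a₀) 2
    rw [sq_abs] at this
    simp only
    linarith [show (h a - h a₀) ^ 2 = h a ^ 2 - 2 * t * h a + t ^ 2 by simp only [t]; ring]
  rw [integral_add h4 (integrable_const _), integral_sub h2 h3, integral_const_mul,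
    integral_const, integral_const, probReal_univ, one_smul, one_smul] at hle
  -- The second moment about t exceeds the variance by (E h - t)².
  nlinarith [sq_nonneg ((∫ a, h a ∂μ) - t)]

lemma piFinSuccAbove_symm_eq_cons {E : Type*} [MeasurableSpace E] {k : ℕ}
    (w : E × (Fin k → E)) :
    (MeasurableEquiv.piFinSuccAbove (fun _ : Fin (k + 1) => E) 0).symm w =
      Fin.cons w.1 w.2 := by
  simp [MeasurableEquiv.piFinSuccAbove_symm_apply, Fin.insertNthEquiv]

lemma integral_pi_succ {E F : Type*} [MeasurableSpace E] {μ : Measure E}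
    [IsProbabilityMeasure μ] [NormedAddCommGroup F] [NormedSpace ℝ F] {k : ℕ}
    (f : (Fin (k + 1) → E) → F) :
    ∫ x, f x ∂(Measure.pi fun _ => μ) =
      ∫ w : E × (Fin k → E), f (Fin.cons w.1 w.2) ∂(μ.prod (Measure.pi fun _ => μ)) := by
  rw [← ((measurePreserving_piFinSuccAbove (fun _ : Fin (k + 1) => μ) 0).symm).integral_comp']
  simp_rw [piFinSuccAbove_symm_eq_cons]

lemma integrable_pi_succ {E F : Type*} [MeasurableSpace E] {μ : Measure E}
    [IsProbabilityMeasure μ] [NormedAddCommGroup F] {k : ℕ}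
    (f : (Fin (k + 1) → E) → F) :
    Integrable f (Measure.pi fun _ => μ) ↔
      Integrable (fun w : E × (Fin k → E) => f (Fin.cons w.1 w.2))
        (μ.prod (Measure.pi fun _ => μ)) := by
  rw [← ((measurePreserving_piFinSuccAbove (fun _ : Fin (k + 1) => μ) 0).symm).integrable_comp_emb
    (MeasurableEquiv.measurableEmbedding _)]
  simp_rw [Function.comp_def, piFinSuccAbove_symm_eq_cons]

lemma measurable_cons {E : Type*} [MeasurableSpace E] {k : ℕ} :
    Measurable (fun w : E × (Fin k → E) => (Fin.cons w.1 w.2 : Fin (k + 1) → E)) := by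
  refine measurable_pi_iff.2 fun i => ?_
  refine Fin.cases ?_ (fun j => ?_) i
  · exact measurable_fst
  · exact (measurable_pi_apply j).comp measurable_snd

/-- The Efron–Stein inequality for functions with bounded differences. -/
lemma variance_pi_le {E : Type*} [MeasurableSpace E] {μ : Measure E} [IsProbabilityMeasure μ]
    {k : ℕ} {f : (Fin k → E) → ℝ} (hm : Measurable f) {B c : ℝ} (hB : ∀ x, |f x| ≤ B)
    (hc : ∀ j x x', (∀ i, i ≠ j → x i = x' i) → |f x - f x'| ≤ c) :
    ∫ x, f x ^ 2 ∂(Measure.pi fun _ => μ) - (∫ x, f x ∂(Measure.pi fun _ => μ)) ^ 2 ≤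
      k * c ^ 2 := by
  induction k with
  | zero =>
    have : ∀ x, f x = f default := fun x => by rw [Subsingleton.elim x default]
    simp_rw [this]
    simp
  | succ k ih =>
    have hmF : Measurable (fun w : E × (Fin k → E) => f (Fin.cons w.1 w.2)) :=
      hm.comp measurable_cons
    have hF : Integrable (fun w : E × (Fin k → E) => f (Fin.cons w.1 w.2))
        (μ.prod (Measure.pi fun _ => μ)) :=
      integrable_of_measurable_bounded hmF fun w => hB _
    have hF2 : Integrable (fun w : E × (Fin k → E) => f (Fin.cons w.1 w.2) ^ 2)
        (μ.prod (Measure.pi fun _ => μ)) := by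
      refine integrable_of_measurable_bounded (hmF.pow_const 2) (B := B ^ 2) fun w => ?_
      rw [norm_pow]
      exact pow_le_pow_left₀ (norm_nonneg _) (hB _) 2
    -- Average out the first coordinate. The total variance is the variance of g, at most k c² by
    -- induction, plus the mean conditional variance, at most c².
    set g : (Fin k → E) → ℝ := fun y => ∫ a, f (Fin.cons a y) ∂μ with hg
    have hgm : Measurable g := (hmF.stronglyMeasurable.integral_prod_left' (μ := μ)).measurable
    have hsec : ∀ y, Integrable (fun a => f (Fin.cons a y)) μ := fun y =>
      integrable_of_measurable_bounded (hmF.comp measurable_prodMk_right) fun a => hB _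
    have hgB : ∀ y, |g y| ≤ B := fun y => by
      have := norm_integral_le_of_norm_le_const (μ := μ) (f := fun a => f (Fin.cons a y))
        (ae_of_all _ fun a => hB _)
      simpa using this
    have hgc : ∀ j y y', (∀ i, i ≠ j → y i = y' i) → |g y - g y'| ≤ c := by
      intro j y y' h
      have := norm_integral_le_of_norm_le_const (μ := μ) (C := c)
        (f := fun a => f (Fin.cons a y) - f (Fin.cons a y'))
        (ae_of_all _ fun a => hc j.succ _ _ fun i hi => by
          induction i using Fin.cases with
          | zero => rfl
          | succ i => exact h i fun hij => hi (by rw [hij]))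
      rw [integral_sub (hsec y) (hsec y')] at this
      simpa using this
    have hih := ih hgm hgB hgc
    have hg2 : Integrable (fun y => g y ^ 2) (Measure.pi fun _ : Fin k => μ) := by
      refine integrable_of_measurable_bounded (hgm.pow_const 2) (B := B ^ 2) fun w => ?_
      rw [norm_pow]
      exact pow_le_pow_left₀ (norm_nonneg _) (hgB _) 2
    rw [integral_pi_succ, integral_pi_succ, integral_prod_symm _ hF, integral_prod_symm _ hF2]
    have hle : ∫ y, ∫ a, f (Fin.cons a y) ^ 2 ∂μ ∂(Measure.pi fun _ => μ) ≤
        ∫ y : Fin k → E, (g y ^ 2 + c ^ 2) ∂(Measure.pi fun _ => μ) := by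
      refine integral_mono hF2.integral_prod_right (hg2.add (integrable_const _)) fun y => ?_
      have := integral_sq_sub_sq_le (μ := μ) (hmF.comp (measurable_prodMk_right (y := y)))
        (c := c) fun a b => hc 0 _ _ fun i hi => by
          induction i using Fin.cases with
          | zero => exact absurd rfl hi
          | succ i => rfl
      simp only [Function.comp] at this
      simp only [hg]
      linarith
    rw [integral_add hg2 (integrable_const _), integral_const, probReal_univ, one_smul] at hle
    push_cast
    simp only [← hg]
    linarith

lemma integral_abs_sub_pi_le {E : Type*} [MeasurableSpace E] {μ : Measure E}
    [IsProbabilityMeasure μ] {k : ℕ} {f : (Fin k → E) → ℝ} (hm : Measurable f) {B c : ℝ}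
    (hB : ∀ x, |f x| ≤ B) (hc0 : 0 ≤ c)
    (hc : ∀ j x x', (∀ i, i ≠ j → x i = x' i) → |f x - f x'| ≤ c) :
    ∫ x, |f x - ∫ y, f y ∂(Measure.pi fun _ => μ)| ∂(Measure.pi fun _ => μ) ≤ √k * c := by
  set m := ∫ y, f y ∂(Measure.pi fun _ => μ) with hmdef
  have hf : Integrable f (Measure.pi fun _ => μ) := integrable_of_measurable_bounded hm hB
  have hf2 : Integrable (fun x => f x ^ 2) (Measure.pi fun _ => μ) := by
    refine integrable_of_measurable_bounded (hm.pow_const 2) (B := B ^ 2) fun w => ?_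
    rw [norm_pow]
    exact pow_le_pow_left₀ (norm_nonneg _) (hB _) 2
  have h1 : Integrable (fun x => 2 * m * f x) (Measure.pi fun _ => μ) := hf.const_mul _
  have h2 : Integrable (fun x => f x ^ 2 - 2 * m * f x) (Measure.pi fun _ => μ) := hf2.sub h1
  have hexp : ∀ x, |f x - m| ^ 2 = f x ^ 2 - 2 * m * f x + m ^ 2 := fun x => by
    rw [sq_abs]
    ring
  have h3 : Integrable (fun x => |f x - m| ^ 2) (Measure.pi fun _ => μ) := by
    simp_rw [hexp]
    exact h2.add (integrable_const _)
  refine (integral_le_sqrt_integral_sq (g := fun x => |f x - m|) (hf.sub (integrable_const m)).abs h3).trans ?_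
  rw [Real.sqrt_le_left (by positivity), mul_pow, Real.sq_sqrt (by positivity)]
  simp_rw [hexp]
  rw [integral_add h2 (integrable_const _), integral_sub hf2 h1, integral_const_mul,
    integral_const, probReal_univ, one_smul, ← hmdef]
  have := variance_pi_le (μ := μ) hm hB hc
  rw [← hmdef] at this
  linarith

/-- The factor 2 is the price of treating real and imaginary parts separately. -/
lemma integral_norm_sub_pi_le {E : Type*} [MeasurableSpace E] {μ : Measure E}
    [IsProbabilityMeasure μ] {k : ℕ} {f : (Fin k → E) → ℂ} (hm : Measurable f) {B c : ℝ}
    (hB : ∀ x, ‖f x‖ ≤ B) (hc0 : 0 ≤ c)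
    (hc : ∀ j x x', (∀ i, i ≠ j → x i = x' i) → ‖f x - f x'‖ ≤ c) :
    ∫ x, ‖f x - ∫ y, f y ∂(Measure.pi fun _ => μ)‖ ∂(Measure.pi fun _ => μ) ≤ 2 * (√k * c) := by
  have hf : Integrable f (Measure.pi fun _ => μ) := integrable_of_measurable_bounded hm hB
  have hre := integral_abs_sub_pi_le (μ := μ) (Complex.measurable_re.comp hm) (B := B)
    (fun x => (Complex.abs_re_le_norm _).trans (hB x)) hc0 fun j x x' h => by
      simp only [Function.comp, ← Complex.sub_re]
      exact (Complex.abs_re_le_norm _).trans (hc j x x' h)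
  have him := integral_abs_sub_pi_le (μ := μ) (Complex.measurable_im.comp hm) (B := B)
    (fun x => (Complex.abs_im_le_norm _).trans (hB x)) hc0 fun j x x' h => by
      simp only [Function.comp, ← Complex.sub_im]
      exact (Complex.abs_im_le_norm _).trans (hc j x x' h)
  simp only [Function.comp] at hre him
  have ere : ∫ y, (f y).re ∂(Measure.pi fun _ => μ) = (∫ y, f y ∂(Measure.pi fun _ => μ)).re :=
    integral_re hf
  have eim : ∫ y, (f y).im ∂(Measure.pi fun _ => μ) = (∫ y, f y ∂(Measure.pi fun _ => μ)).im :=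
    integral_im hf
  rw [ere] at hre
  rw [eim] at him
  set m := ∫ y, f y ∂(Measure.pi fun _ => μ)
  have h1 : Integrable (fun x => f x - m) (Measure.pi fun _ => μ) := hf.sub (integrable_const m)
  have h2 : Integrable (fun x => |(f x).re - m.re|) (Measure.pi fun _ => μ) :=
    (hf.re.sub (integrable_const m.re)).abs
  have h3 : Integrable (fun x => |(f x).im - m.im|) (Measure.pi fun _ => μ) :=
    (hf.im.sub (integrable_const m.im)).abs
  calc ∫ x, ‖f x - m‖ ∂(Measure.pi fun _ => μ)
      ≤ ∫ x, (|(f x).re - m.re| + |(f x).im - m.im|) ∂(Measure.pi fun _ => μ) := by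
        refine integral_mono h1.norm (h2.add h3) fun x => ?_
        have := Complex.norm_le_abs_re_add_abs_im (f x - m)
        simpa using this
    _ ≤ 2 * (√k * c) := by
        rw [integral_add h2 h3]
        linarith

/-- Serves to integrate one column first with the others frozen, when the conditional bound is
uniform in the frozen ones. -/
lemma integrable_prod_of_section_le {E F : Type*} [MeasurableSpace E] [MeasurableSpace F]
    {μ : Measure E} {ρ : Measure F} [IsProbabilityMeasure μ] [IsProbabilityMeasure ρ]
    {f : E × F → ℝ} (hm : Measurable f) (h0 : ∀ w, 0 ≤ f w) {B : ℝ}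
    (h : ∀ y, Integrable (fun a => f (a, y)) μ ∧ ∫ a, f (a, y) ∂μ ≤ B) :
    Integrable f (μ.prod ρ) ∧ ∫ w, f w ∂(μ.prod ρ) ≤ B := by
  have h1 : Integrable f (μ.prod ρ) := by
    rw [integrable_prod_iff' hm.aestronglyMeasurable]
    refine ⟨ae_of_all _ fun y => (h y).1, ?_⟩
    refine integrable_of_measurable_bounded
      (hm.norm.stronglyMeasurable.integral_prod_left' (μ := μ)).measurable (B := B) fun y => ?_
    rw [Real.norm_of_nonneg (integral_nonneg fun _ => norm_nonneg _)]
    simp_rw [Real.norm_of_nonneg (h0 _)]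
    exact (h y).2
  refine ⟨h1, ?_⟩
  rw [integral_prod_symm _ h1]
  calc _ ≤ ∫ _y, B ∂ρ := integral_mono h1.integral_prod_right (integrable_const _) fun y => (h y).2
    _ = B := by simp

lemma integral_pi_comp_perm {E F : Type*} [MeasurableSpace E] {μ : Measure E}
    [IsProbabilityMeasure μ] [NormedAddCommGroup F] [NormedSpace ℝ F] {k : ℕ}
    (f : (Fin k → E) → F) (σ : Equiv.Perm (Fin k)) :
    ∫ x, f (fun i => x (σ i)) ∂(Measure.pi fun _ => μ) = ∫ x, f x ∂(Measure.pi fun _ => μ) := by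
  have key := (measurePreserving_piCongrLeft (fun _ : Fin k => μ) σ.symm).integral_comp' f
  rw [← key]
  congr 1
  funext x
  congr 1
  funext i
  have := Equiv.piCongrLeft_apply_apply (fun _ : Fin k => E) σ.symm x (σ i)
  rw [σ.symm_apply_apply] at this
  exact this.symm

end ProductMeasure

/-! ### Measurability of the spectral quantities in the columns. -/

section Measurability

lemma measurable_looCov_apply {ι : Type*} {p : ℕ} (j : Fin p) (i k : ι) :
    Measurable fun Z : Fin p → ι → ℝ => looCov Z j i k := by
  simp only [looCov, Matrix.smul_apply, Matrix.sum_apply, Matrix.vecMulVec_apply]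
  fun_prop

lemma measurable_sampleCov_apply {ι : Type*} {p : ℕ} (i k : ι) :
    Measurable fun Z : Fin p → ι → ℝ => sampleCov Z i k := by
  simp only [sampleCov, Matrix.smul_apply, Matrix.sum_apply, Matrix.vecMulVec_apply]
  fun_prop

variable {ι : Type*} [Fintype ι] [DecidableEq ι]

/-- By Cramer's rule an entry is a polynomial in the entries of A times the inverse of another one,
and inversion on ℂ is measurable even at 0. -/
lemma measurable_realResolvent_apply {Ω : Type*} [MeasurableSpace Ω] {A : Ω → Matrix ι ι ℝ}
    (hA : ∀ i j, Measurable fun ω => A ω i j) (z : ℂ) (i j : ι) :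
    Measurable fun ω => realResolvent (A ω) z i j := by
  have hpi : Measurable fun ω => (fun i j => A ω i j : ι → ι → ℝ) :=
    measurable_pi_iff.2 fun i => measurable_pi_iff.2 fun j => hA i j
  have hM : Continuous fun B : ι → ι → ℝ =>
      (z • (1 : Matrix ι ι ℂ) - (Matrix.of B).map Complex.ofReal) := by
    refine continuous_const.sub ?_
    refine continuous_pi fun i => continuous_pi fun j => ?_
    simp only [Matrix.map_apply, Matrix.of_apply]
    fun_prop
  have h1 := hM.matrix_det.measurable.comp hpi
  have h2 := (hM.matrix_adjugate.matrix_elem i j).measurable.comp hpi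
  have e : (fun ω => realResolvent (A ω) z i j) = fun ω =>
      (z • (1 : Matrix ι ι ℂ) - (A ω).map Complex.ofReal).det⁻¹ *
        (z • (1 : Matrix ι ι ℂ) - (A ω).map Complex.ofReal).adjugate i j := by
    funext ω
    rw [realResolvent, Matrix.inv_def, Ring.inverse_eq_inv', Matrix.smul_apply, smul_eq_mul]
  rw [e]
  exact h1.inv.mul h2

variable {p : ℕ}

lemma measurable_stieltjesESD (z : ℂ) :
    Measurable fun Z : Fin p → ι → ℝ => stieltjesESD (sampleCov Z) z := by
  have := measurable_realResolvent_apply (fun i k : ι => measurable_sampleCov_apply (p := p) i k) z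
  simp only [stieltjesESD, Matrix.trace, Matrix.diag_apply]
  fun_prop

lemma measurable_trace_looResolvent (j : Fin p) (z : ℂ) :
    Measurable fun Z : Fin p → ι → ℝ => (realResolvent (looCov Z j) z).trace := by
  have := measurable_realResolvent_apply (fun i k : ι => measurable_looCov_apply j i k) z
  simp only [Matrix.trace, Matrix.diag_apply]
  fun_prop

lemma measurable_quadForm (j : Fin p) (z : ℂ) :
    Measurable fun Z : Fin p → ι → ℝ => quadForm Z j z := by
  have := measurable_realResolvent_apply (fun i k : ι => measurable_looCov_apply j i k) z
  simp only [quadForm_eq, dotProduct, Matrix.mulVec]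
  fun_prop

end Measurability

/-! ### Estimates for a fixed matrix size. -/

section FixedSize

variable {ν : Measure ℝ} [IsProbabilityMeasure ν] {L : ℝ} {n d : ℕ}

lemma integral_norm_quadForm_sub_trace_le (hν : MomentBound ν L) (hdn : d ≤ n) (hn : 0 < n)
    {p : ℕ} [NeZero p] {z : ℂ} (hz : 0 < z.im) :
    Integrable (fun Z : Fin p → Row n d → ℝ =>
      ‖quadForm Z 0 z - (p : ℂ)⁻¹ * (realResolvent (looCov Z 0) z).trace‖)
      (Measure.pi fun _ => tensorLaw n d ν) ∧
    ∫ Z : Fin p → Row n d → ℝ, ‖quadForm Z 0 z - (p : ℂ)⁻¹ * (realResolvent (looCov Z 0) z).trace‖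
      ∂(Measure.pi fun _ => tensorLaw n d ν) ≤
      (p : ℝ)⁻¹ * (n.choose d * (z.im)⁻¹ * √(Real.exp (2 * d * (L * (d / n))) - 1)) := by
  obtain ⟨k, rfl⟩ : ∃ k, p = k + 1 := ⟨p - 1, by have := NeZero.pos p; omega⟩
  have hmeas : Measurable (fun Z : Fin (k + 1) → Row n d → ℝ =>
      ‖quadForm Z 0 z - ((k + 1 : ℕ) : ℂ)⁻¹ * (realResolvent (looCov Z 0) z).trace‖) :=
    ((measurable_quadForm 0 z).sub
      ((measurable_trace_looResolvent 0 z).const_mul _)).norm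
  rw [integrable_pi_succ, integral_pi_succ]
  refine integrable_prod_of_section_le (hmeas.comp measurable_cons) (fun _ => norm_nonneg _)
    fun y => ?_
  set A := realResolvent (looCov (Fin.cons 0 y : Fin (k + 1) → Row n d → ℝ) 0) z with hA
  have hAa : ∀ a, realResolvent (looCov (Fin.cons a y : Fin (k + 1) → Row n d → ℝ) 0) z = A := by
    intro a
    rw [hA, looCov_congr (Z := Fin.cons a y) (Z' := Fin.cons 0 y)]
    intro i hi
    induction i using Fin.cases with
    | zero => exact absurd rfl hi
    | succ i => rfl
  have hrep : ∀ a : Row n d → ℝ, ‖quadForm (Fin.cons a y : Fin (k + 1) → Row n d → ℝ) 0 z -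
      ((k + 1 : ℕ) : ℂ)⁻¹ *
        (realResolvent (looCov (Fin.cons a y : Fin (k + 1) → Row n d → ℝ) 0) z).trace‖ =
      ((k + 1 : ℕ) : ℝ)⁻¹ * ‖(fun i => (a i : ℂ)) ⬝ᵥ A.mulVec (fun i => (a i : ℂ)) - A.trace‖ := by
    intro a
    rw [quadForm_eq, hAa, Fin.cons_zero, Complex.ofReal_inv, Complex.ofReal_natCast, ← mul_sub,
      norm_mul, norm_inv, Complex.norm_natCast]
  simp only [Function.comp_def, hrep]
  obtain ⟨h1, h2⟩ := integral_norm_sq_quadratic_sub_trace_le hν hdn hn A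
    (sum_sq_realResolvent_col_le (looCov_posSemidef _ _) hz)
  have hmeas' : Measurable (fun a : Row n d → ℝ =>
      ‖(fun i => (a i : ℂ)) ⬝ᵥ A.mulVec (fun i => (a i : ℂ)) - A.trace‖) := by
    unfold dotProduct Matrix.mulVec dotProduct
    fun_prop
  have h3 : Integrable (fun a : Row n d → ℝ =>
      ‖(fun i => (a i : ℂ)) ⬝ᵥ A.mulVec (fun i => (a i : ℂ)) - A.trace‖) (tensorLaw n d ν) := by
    refine ((integrable_const (1 : ℝ)).add h1).mono' hmeas'.aestronglyMeasurable
      (ae_of_all _ fun a => ?_)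
    rw [norm_norm]
    simp only [Pi.add_apply]
    nlinarith [sq_nonneg (‖(fun i => (a i : ℂ)) ⬝ᵥ A.mulVec (fun i => (a i : ℂ)) - A.trace‖ - 1)]
  refine ⟨h3.const_mul _, ?_⟩
  rw [integral_const_mul]
  gcongr
  refine (integral_le_sqrt_integral_sq h3 h1).trans ?_
  refine (Real.sqrt_le_sqrt h2).trans (le_of_eq ?_)
  rw [← mul_pow, Real.sqrt_mul (by positivity), Real.sqrt_sq (by positivity)]

lemma integrable_stieltjesESD {p : ℕ} {z : ℂ} (hz : 0 < z.im) :
    Integrable (fun Z : Fin p → Row n d → ℝ => stieltjesESD (sampleCov Z) z)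
      (Measure.pi fun _ => tensorLaw n d ν) :=
  integrable_of_measurable_bounded (measurable_stieltjesESD z) fun Z =>
    norm_stieltjesESD_le (sampleCov_posSemidef Z) hz

lemma integrable_one_div_one_sub_quadForm {p : ℕ} (j : Fin p) {z : ℂ} (hz : 0 < z.im) :
    Integrable (fun Z : Fin p → Row n d → ℝ => 1 / (1 - quadForm Z j z))
      (Measure.pi fun _ => tensorLaw n d ν) :=
  integrable_of_measurable_bounded (measurable_const.div
    (measurable_const.sub (measurable_quadForm j z))) fun Z =>
      norm_one_div_one_sub_quadForm_le Z j hz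

lemma norm_integral_stieltjesESD_le {p : ℕ} {z : ℂ} (hz : 0 < z.im) :
    ‖∫ Z : Fin p → Row n d → ℝ, stieltjesESD (sampleCov Z) z
      ∂(Measure.pi fun _ => tensorLaw n d ν)‖ ≤ (z.im)⁻¹ := by
  have := norm_integral_le_of_norm_le_const (μ := Measure.pi fun _ : Fin p => tensorLaw n d ν)
    (ae_of_all _ fun Z => norm_stieltjesESD_le (sampleCov_posSemidef Z) hz)
  simpa using this

/-- The quadratic form is close to the deterministic quantity `(N / p) 𝔼[m]`. -/
lemma integral_norm_quadForm_sub_le (hν : MomentBound ν L) (hdn : d ≤ n) (hn : 0 < n)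
    {p : ℕ} [NeZero p] {z : ℂ} (hz : 0 < z.im) :
    Integrable (fun Z : Fin p → Row n d → ℝ => ‖quadForm Z 0 z - (n.choose d : ℂ) / p *
      ∫ Z : Fin p → Row n d → ℝ, stieltjesESD (sampleCov Z) z
        ∂(Measure.pi fun _ => tensorLaw n d ν)‖) (Measure.pi fun _ => tensorLaw n d ν) ∧
    ∫ Z : Fin p → Row n d → ℝ, ‖quadForm Z 0 z - (n.choose d : ℂ) / p *
      ∫ Z : Fin p → Row n d → ℝ, stieltjesESD (sampleCov Z) z
        ∂(Measure.pi fun _ => tensorLaw n d ν)‖ ∂(Measure.pi fun _ => tensorLaw n d ν) ≤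
      (z.im)⁻¹ * ((n.choose d : ℝ) / p * √(Real.exp (2 * d * (L * (d / n))) - 1) + (p : ℝ)⁻¹ +
        4 * (√p)⁻¹) := by
  have hp : (0 : ℝ) < p := by exact_mod_cast NeZero.pos p
  have hN : (0 : ℝ) < n.choose d := by exact_mod_cast Nat.choose_pos hdn
  set M := ∫ Z : Fin p → Row n d → ℝ, stieltjesESD (sampleCov Z) z
        ∂(Measure.pi fun _ => tensorLaw n d ν) with hM
  obtain ⟨hA1, hA2⟩ := integral_norm_quadForm_sub_trace_le hν hdn hn (p := p) hz
  have hB := integral_norm_sub_pi_le (μ := tensorLaw n d ν) (k := p)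
    (measurable_stieltjesESD (ι := Row n d) z)
    (fun Z => norm_stieltjesESD_le (sampleCov_posSemidef Z) hz)
    (c := 2 * (z.im)⁻¹ / n.choose d) (by positivity) fun j x x' h => by
      have := norm_stieltjesESD_sampleCov_sub_le h hz
      rwa [card_row] at this
  rw [← hM] at hB
  have hBi : Integrable (fun Z : Fin p → Row n d → ℝ => ‖stieltjesESD (sampleCov Z) z - M‖)
      (Measure.pi fun _ => tensorLaw n d ν) :=
    ((integrable_stieltjesESD hz).sub (integrable_const M)).norm
  have hpt : ∀ Z : Fin p → Row n d → ℝ, ‖quadForm Z 0 z - (n.choose d : ℂ) / p * M‖ ≤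
      ‖quadForm Z 0 z - (p : ℂ)⁻¹ * (realResolvent (looCov Z 0) z).trace‖ +
        ((p : ℝ)⁻¹ * (z.im)⁻¹ + (n.choose d : ℝ) / p * ‖stieltjesESD (sampleCov Z) z - M‖) := by
    intro Z
    -- Three errors: the quadratic form against its trace, the removal of one column, and the
    -- fluctuation of the normalized trace. The last is (N/p) · 2√p · 2/(N Im z), whence the term
    -- 4/√p.
    have e : quadForm Z 0 z - (n.choose d : ℂ) / p * M =
        (quadForm Z 0 z - (p : ℂ)⁻¹ * (realResolvent (looCov Z 0) z).trace) +
        (-((p : ℂ)⁻¹ * ((realResolvent (sampleCov Z) z).trace -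
          (realResolvent (looCov Z 0) z).trace)) +
        (n.choose d : ℂ) / p * (stieltjesESD (sampleCov Z) z - M)) := by
      have hNC : (n.choose d : ℂ) ≠ 0 := by exact_mod_cast hN.ne'
      rw [stieltjesESD, card_row]
      field_simp
      ring
    rw [e]
    refine (norm_add_le _ _).trans (add_le_add le_rfl ((norm_add_le _ _).trans
      (add_le_add ?_ (le_of_eq ?_))))
    · rw [norm_neg, norm_mul, norm_inv, Complex.norm_natCast]
      have := norm_trace_realResolvent_add_sub_le (looCov_posSemidef Z 0) hz (Z 0)
        (c := (p : ℝ)⁻¹) (by positivity)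
      rw [looCov_add] at this
      gcongr
    · rw [norm_mul, norm_div, Complex.norm_natCast, Complex.norm_natCast]
  have hbi : Integrable (fun Z : Fin p → Row n d → ℝ => (p : ℝ)⁻¹ * (z.im)⁻¹ +
      (n.choose d : ℝ) / p * ‖stieltjesESD (sampleCov Z) z - M‖)
      (Measure.pi fun _ => tensorLaw n d ν) := (integrable_const _).add (hBi.const_mul _)
  have hint : Integrable (fun Z : Fin p → Row n d → ℝ =>
      ‖quadForm Z 0 z - (n.choose d : ℂ) / p * M‖) (Measure.pi fun _ => tensorLaw n d ν) := by
    refine (hA1.add hbi).mono'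
      ((measurable_quadForm 0 z).sub measurable_const).norm.aestronglyMeasurable
      (ae_of_all _ fun Z => ?_)
    rw [norm_norm]
    exact hpt Z
  refine ⟨hint, (integral_mono hint (hA1.add hbi) hpt).trans ?_⟩
  simp only [Pi.add_apply]
  rw [integral_add hA1 hbi, integral_add (integrable_const _) (hBi.const_mul _), integral_const,
    probReal_univ, one_smul, integral_const_mul]
  have hs : (√p)⁻¹ = √p / p := by
    rw [eq_div_iff hp.ne', inv_mul_eq_iff_eq_mul₀ (by positivity), Real.mul_self_sqrt hp.le]
  calc _ ≤ (p : ℝ)⁻¹ * (n.choose d * (z.im)⁻¹ * √(Real.exp (2 * d * (L * (d / n))) - 1)) +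
        ((p : ℝ)⁻¹ * (z.im)⁻¹ +
          (n.choose d : ℝ) / p * (2 * (√p * (2 * (z.im)⁻¹ / n.choose d)))) := by gcongr
    _ = _ := by
        rw [hs]
        field_simp
        ring

lemma quadForm_comp_perm {ι : Type*} [Fintype ι] [DecidableEq ι] {p : ℕ} (Z : Fin p → ι → ℝ)
    (σ : Equiv.Perm (Fin p)) (j : Fin p) (z : ℂ) :
    quadForm (fun i => Z (σ i)) j z = quadForm Z (σ j) z := by
  have h : sampleCov (fun i => Z (σ i)) = sampleCov Z := by
    rw [sampleCov, sampleCov, Equiv.sum_comp σ fun i => Matrix.vecMulVec (Z i) (Z i)]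
  rw [quadForm, quadForm, looResolvent, looResolvent, h]

/-- The trace identity in expectation. -/
lemma integral_one_div_one_sub_quadForm_eq {p : ℕ} [NeZero p] {z : ℂ} (hz : 0 < z.im)
    (hdn : d ≤ n) :
    ∫ Z : Fin p → Row n d → ℝ, 1 / (1 - quadForm Z 0 z)
      ∂(Measure.pi fun _ => tensorLaw n d ν) =
    (n.choose d : ℂ) / p * (z * ∫ Z : Fin p → Row n d → ℝ, stieltjesESD (sampleCov Z) z
      ∂(Measure.pi fun _ => tensorLaw n d ν)) + 1 - (n.choose d : ℂ) / p := by
  have hp : (p : ℂ) ≠ 0 := by exact_mod_cast NeZero.ne p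
  have hN : (n.choose d : ℂ) ≠ 0 := by exact_mod_cast (Nat.choose_pos hdn).ne'
  set ρ : Measure (Fin p → Row n d → ℝ) := Measure.pi fun _ => tensorLaw n d ν
  -- Exchangeability: swapping columns 0 and j preserves the product measure and S.
  have hex : ∀ j : Fin p, ∫ Z, 1 / (1 - quadForm Z j z) ∂ρ =
      ∫ Z, 1 / (1 - quadForm Z 0 z) ∂ρ := by
    intro j
    rw [← integral_pi_comp_perm (μ := tensorLaw n d ν)
      (fun Z : Fin p → Row n d → ℝ => 1 / (1 - quadForm Z 0 z)) (Equiv.swap 0 j)]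
    simp_rw [quadForm_comp_perm, Equiv.swap_apply_left]
    rfl
  have hpt : ∀ Z : Fin p → Row n d → ℝ, ∑ j, (1 / (1 - quadForm Z j z)) =
      (n.choose d : ℂ) * z * stieltjesESD (sampleCov Z) z + (p - n.choose d) := by
    intro Z
    have h := trace_realResolvent_sampleCov Z hz
    rw [Finset.sum_sub_distrib, card_row] at h
    simp only [Finset.sum_const, Finset.card_univ, Fintype.card_fin, nsmul_eq_mul, mul_one] at h
    rw [stieltjesESD, card_row]
    field_simp
    linear_combination -h
  have hsum : ∑ j : Fin p, ∫ Z, 1 / (1 - quadForm Z j z) ∂ρ =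
      (n.choose d : ℂ) * z * ∫ Z, stieltjesESD (sampleCov Z) z ∂ρ + (p - n.choose d) := by
    rw [← integral_finsetSum _ fun j _ => integrable_one_div_one_sub_quadForm j hz]
    simp_rw [hpt]
    rw [integral_add ((integrable_stieltjesESD hz).const_mul _) (integrable_const _),
      integral_const_mul, integral_const, probReal_univ, one_smul]
  simp_rw [hex] at hsum
  rw [Finset.sum_const, Finset.card_univ, Fintype.card_fin, nsmul_eq_mul] at hsum
  have hsum' := congrArg (fun w : ℂ => w / p) hsum
  simp only [mul_div_cancel_left₀ _ hp] at hsum'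
  rw [hsum']
  field_simp
  ring

/-- The difference of reciprocals is (q - c)/((1 - q)(1 - c)), and 1/(1 - q) is bounded surely by
|z|/Im z, so L¹ closeness of q to c suffices. -/
lemma norm_integral_one_div_sub_le {p : ℕ} [NeZero p] {z : ℂ} (hz : 0 < z.im) {c : ℂ}
    (hc : 1 - c ≠ 0) {B : ℝ}
    (h : Integrable (fun Z : Fin p → Row n d → ℝ => ‖quadForm Z 0 z - c‖)
        (Measure.pi fun _ => tensorLaw n d ν) ∧
      ∫ Z : Fin p → Row n d → ℝ, ‖quadForm Z 0 z - c‖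
        ∂(Measure.pi fun _ => tensorLaw n d ν) ≤ B) :
    ‖(∫ Z : Fin p → Row n d → ℝ, 1 / (1 - quadForm Z 0 z)
      ∂(Measure.pi fun _ => tensorLaw n d ν)) - 1 / (1 - c)‖ ≤
      ‖z‖ / z.im * ‖1 / (1 - c)‖ * B := by
  set ρ : Measure (Fin p → Row n d → ℝ) := Measure.pi fun _ => tensorLaw n d ν
  have e : (∫ Z, 1 / (1 - quadForm Z 0 z) ∂ρ) - 1 / (1 - c) =
      ∫ Z, (1 / (1 - quadForm Z 0 z) - 1 / (1 - c)) ∂ρ := by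
    rw [integral_sub (integrable_one_div_one_sub_quadForm 0 hz) (integrable_const _),
      integral_const, probReal_univ, one_smul]
  rw [e]
  calc ‖∫ Z, (1 / (1 - quadForm Z 0 z) - 1 / (1 - c)) ∂ρ‖
      ≤ ∫ Z, ‖z‖ / z.im * ‖1 / (1 - c)‖ * ‖quadForm Z 0 z - c‖ ∂ρ := by
        refine norm_integral_le_of_norm_le (h.1.const_mul _) (ae_of_all _ fun Z => ?_)
        have hq := one_sub_quadForm_ne_zero Z 0 hz
        have : 1 / (1 - quadForm Z 0 z) - 1 / (1 - c) =
            1 / (1 - quadForm Z 0 z) * (1 / (1 - c)) * (quadForm Z 0 z - c) := by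
          field_simp
          ring
        rw [this, norm_mul, norm_mul]
        gcongr
        exact norm_one_div_one_sub_quadForm_le Z 0 hz
    _ ≤ _ := by
        rw [integral_const_mul]
        gcongr
        exact h.2

end FixedSize

/-! ### From i.i.d. columns on an abstract probability space to the product measure. -/

section Transfer

variable {Ω E : Type*} [MeasurableSpace Ω] [MeasurableSpace E] {P : Measure Ω} {p : ℕ}
  {Z : Fin p → Ω → E} {μ : Measure E}

lemma map_eq_pi_of_iIndepFun (hindep : iIndepFun Z P) (hlaw : ∀ j, HasLaw (Z j) μ P) :
    P.map (fun ω j => Z j ω) = Measure.pi fun _ => μ := by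
  rw [hindep.map_fun_eq_pi_map fun j => (hlaw j).aemeasurable]
  simp_rw [(hlaw _).map_eq]

lemma integral_eq_integral_pi (hindep : iIndepFun Z P) (hlaw : ∀ j, HasLaw (Z j) μ P)
    {f : (Fin p → E) → ℂ} (hf : Measurable f) :
    ∫ ω, f (fun j => Z j ω) ∂P = ∫ x, f x ∂(Measure.pi fun _ => μ) := by
  rw [← map_eq_pi_of_iIndepFun hindep hlaw, integral_map
    (aemeasurable_pi_lambda _ fun j => (hlaw j).aemeasurable) hf.aestronglyMeasurable]

lemma integrable_of_integrable_pi (hindep : iIndepFun Z P) (hlaw : ∀ j, HasLaw (Z j) μ P)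
    {f : (Fin p → E) → ℂ} (hf : Integrable f (Measure.pi fun _ => μ)) :
    Integrable (fun ω => f (fun j => Z j ω)) P := by
  rw [← map_eq_pi_of_iIndepFun hindep hlaw] at hf
  exact hf.comp_aemeasurable (aemeasurable_pi_lambda _ fun j => (hlaw j).aemeasurable)

end Transfer

/-! ### The Stieltjes transform of the Marchenko–Pastur law. -/

section MarchenkoPastur

open Real in
/-- The Poisson-type integral `∫₀^π sin² θ / (1 - 2u cos θ + u²) dθ = π / 2`. -/
lemma integral_sin_sq_div {u : ℂ} (hu : ‖u‖ < 1) :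
    ∫ θ in (0 : ℝ)..π, (sin θ : ℂ) ^ 2 / (1 - 2 * u * cos θ + u ^ 2) =
      ((π / 2 : ℝ) : ℂ) := by
  have hden : ∀ ζ : ℂ, ‖ζ‖ ≤ 1 → 1 - u * ζ ≠ 0 := by
    intro ζ hζ h
    have h1 : u * ζ = 1 := (sub_eq_zero.1 h).symm
    have h2 := congrArg norm h1
    rw [norm_mul, norm_one] at h2
    nlinarith [norm_nonneg u, norm_nonneg ζ]
  have hexp : ∀ θ : ℝ, ‖Complex.exp (θ * Complex.I)‖ ≤ 1 := fun θ =>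
    (Complex.norm_exp_ofReal_mul_I θ).le
  have hexp' : ∀ θ : ℝ, ‖Complex.exp (-(θ * Complex.I))‖ ≤ 1 := fun θ => by
    have := hexp (-θ)
    rwa [Complex.ofReal_neg, neg_mul] at this
  set G : ℝ → ℂ := fun θ =>
    (Complex.exp (θ * Complex.I) ^ 2 - 1) / (1 - u * Complex.exp (θ * Complex.I)) with hG
  have hGc : Continuous G := by
    refine Continuous.div (by fun_prop) (by fun_prop) fun θ => hden _ (hexp θ)
  -- Mean value property of (ζ² - 1)/(1 - uζ), holomorphic near the closed unit disc, whose value at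
  -- 0 is -1.
  have hmean : ∫ θ in (0 : ℝ)..2 * π, G θ = -(2 * π : ℝ) := by
    have hd : DiffContOnCl ℂ (fun ζ : ℂ => (ζ ^ 2 - 1) / (1 - u * ζ)) (Metric.ball 0 |(1 : ℝ)|) := by
      refine DifferentiableOn.diffContOnCl ?_
      rw [abs_one, closure_ball _ one_ne_zero]
      refine DifferentiableOn.div (by fun_prop) (by fun_prop) fun ζ hζ => hden ζ ?_
      simpa using hζ
    have h := hd.circleAverage
    rw [circleAverage_def] at h
    simp only [circleMap, Complex.ofReal_one, one_mul, zero_add, ne_eq, OfNat.ofNat_ne_zero,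
      not_false_eq_true, zero_pow, mul_zero, sub_zero, div_one, zero_sub] at h
    rw [inv_smul_eq_iff₀ (by positivity)] at h
    simp only [hG]
    rw [h]
    simp
  have hi : ∀ a b : ℝ, IntervalIntegrable G volume a b := fun a b => hGc.intervalIntegrable a b
  have hsplit : ∫ θ in (0 : ℝ)..2 * π, G θ = ∫ θ in (0 : ℝ)..π, (G θ + G (2 * π - θ)) := by
    have hGr : Continuous fun θ => G (2 * π - θ) := hGc.comp (by fun_prop)
    rw [intervalIntegral.integral_add (hi _ _) (hGr.intervalIntegrable _ _),
      intervalIntegral.integral_comp_sub_left G (2 * π), sub_zero,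
      show 2 * π - π = π by ring, intervalIntegral.integral_add_adjacent_intervals (hi _ _) (hi _ _)]
  -- Pairing θ with 2π - θ replaces ζ by its inverse; over a common denominator the sum is -4 times
  -- the wanted integrand.
  have hpt : ∀ θ : ℝ, G θ + G (2 * π - θ) =
      -4 * ((sin θ : ℂ) ^ 2 / (1 - 2 * u * cos θ + u ^ 2)) := by
    intro θ
    have h1 := hden _ (hexp θ)
    have h2 := hden _ (hexp' θ)
    have e2 : Complex.exp ((2 * π - θ : ℝ) * Complex.I) = Complex.exp (-(θ * Complex.I)) := by
      push_cast
      rw [sub_mul, sub_eq_add_neg, Complex.exp_add, Complex.exp_two_pi_mul_I, one_mul]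
    have hs : (sin θ : ℂ) = (Complex.exp (-(θ * Complex.I)) - Complex.exp (θ * Complex.I)) *
        Complex.I / 2 := by
      rw [Complex.ofReal_sin, Complex.sin, neg_mul]
    have hc : (cos θ : ℂ) = (Complex.exp (θ * Complex.I) + Complex.exp (-(θ * Complex.I))) / 2 := by
      rw [Complex.ofReal_cos, Complex.cos, neg_mul]
    have hprod : Complex.exp (θ * Complex.I) * Complex.exp (-(θ * Complex.I)) = 1 := by
      rw [← Complex.exp_add, add_neg_cancel, Complex.exp_zero]
    simp only [hG]
    rw [e2, hs, hc]
    set a := Complex.exp (θ * Complex.I)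
    set b := Complex.exp (-(θ * Complex.I))
    have hfac : 1 - 2 * u * ((a + b) / 2) + u ^ 2 = (1 - u * a) * (1 - u * b) := by
      linear_combination -u ^ 2 * hprod
    rw [hfac, div_add_div _ _ h1 h2, ← mul_div_assoc]
    congr 1
    linear_combination (2 - u * a - u * b) * hprod + (b - a) ^ 2 * Complex.I_sq
  rw [hsplit] at hmean
  simp_rw [hpt] at hmean
  rw [intervalIntegral.integral_const_mul] at hmean
  push_cast at hmean ⊢
  linear_combination (-1 / 4 : ℂ) * hmean

/-- The two solutions of `u + u⁻¹ = 2w` are not on the unit circle when `w` is not real. -/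
lemma exists_joukowski {w : ℂ} (hw : w.im ≠ 0) : ∃ u : ℂ, ‖u‖ < 1 ∧ u ≠ 0 ∧ 1 + u ^ 2 = 2 * w * u := by
  obtain ⟨s, hs⟩ := IsAlgClosed.exists_pow_nat_eq (w ^ 2 - 1) (n := 2) (by norm_num)
  have hprod : (w + s) * (w - s) = 1 := by linear_combination -hs
  have hn : ‖w + s‖ * ‖w - s‖ = 1 := by rw [← norm_mul, hprod, norm_one]
  have h1 : w + s ≠ 0 := left_ne_zero_of_mul_eq_one hprod
  have h2 : w - s ≠ 0 := right_ne_zero_of_mul_eq_one hprod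
  rcases lt_trichotomy ‖w + s‖ 1 with h | h | h
  · exact ⟨w + s, h, h1, by linear_combination hs⟩
  · exfalso
    -- The roots w ± s have product 1; on the unit circle they would be conjugate, making their sum
    -- 2w real.
    have hconj : w - s = star (w + s) := by
      have := Complex.mul_conj' (w + s)
      rw [h, Complex.ofReal_one, one_pow] at this
      exact mul_left_cancel₀ h1 (hprod.trans this.symm)
    have := congrArg Complex.im hconj
    simp at this
    apply hw
    linarith
  · refine ⟨w - s, ?_, h2, by linear_combination hs⟩
    have := norm_pos_iff.2 h2
    nlinarith

/-- The parametrisation of the bulk of the Marchenko–Pastur law. -/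
def mpCoord (γ θ : ℝ) : ℝ := 1 + γ + 2 * √γ * Real.cos θ

/-- The difference is (1 - √γ)². The bound remains useful at γ = 1, where the bulk touches 0. -/
lemma two_sqrt_mul_le_mpCoord {γ : ℝ} (hγ : 0 < γ) (θ : ℝ) :
    2 * √γ * (1 + Real.cos θ) ≤ mpCoord γ θ := by
  have := sq_nonneg (1 - √γ)
  have h2 := Real.sq_sqrt hγ.le
  unfold mpCoord
  nlinarith

lemma neg_one_lt_cos_of_mem {θ : ℝ} (h : θ ∈ Set.Ioo 0 Real.pi) : 0 < 1 + Real.cos θ := by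
  have := Real.strictAntiOn_cos (Set.Ioo_subset_Icc_self h) (Set.right_mem_Icc.2 Real.pi_pos.le) h.2
  rw [Real.cos_pi] at this
  linarith

lemma mpCoord_pos {γ : ℝ} (hγ : 0 < γ) {θ : ℝ} (h : θ ∈ Set.Ioo 0 Real.pi) :
    0 < mpCoord γ θ := by
  refine lt_of_lt_of_le ?_ (two_sqrt_mul_le_mpCoord hγ θ)
  have := neg_one_lt_cos_of_mem h
  positivity

lemma mpCoord_image {γ : ℝ} (hγ : 0 < γ) :
    mpCoord γ '' Set.Ioo 0 Real.pi = Set.Ioo ((1 - √γ) ^ 2) ((1 + √γ) ^ 2) := by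
  have hs : 0 < √γ := Real.sqrt_pos.2 hγ
  have h2 := Real.sq_sqrt hγ.le
  ext y
  constructor
  · rintro ⟨θ, hθ, rfl⟩
    have h1 := neg_one_lt_cos_of_mem hθ
    have h3 := Real.strictAntiOn_cos (Set.left_mem_Icc.2 Real.pi_pos.le)
      (Set.Ioo_subset_Icc_self hθ) hθ.1
    rw [Real.cos_zero] at h3
    unfold mpCoord
    constructor <;> nlinarith
  · rintro ⟨h1, h3⟩
    set c := (y - 1 - γ) / (2 * √γ) with hc
    have hc1 : -1 < c := by
      rw [hc, lt_div_iff₀ (by positivity)]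
      nlinarith
    have hc2 : c < 1 := by
      rw [hc, div_lt_iff₀ (by positivity)]
      nlinarith
    refine ⟨Real.arccos c, ⟨Real.arccos_pos.2 hc2, ?_⟩, ?_⟩
    · refine lt_of_le_of_ne (Real.arccos_le_pi c) fun h => ?_
      rw [Real.arccos_eq_pi] at h
      linarith
    · rw [mpCoord, Real.cos_arccos hc1.le hc2.le, hc]
      field_simp
      ring

lemma mpCoord_injOn {γ : ℝ} (hγ : 0 < γ) : Set.InjOn (mpCoord γ) (Set.Ioo 0 Real.pi) := by
  have hs : 0 < √γ := Real.sqrt_pos.2 hγ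
  intro a ha b hb hab
  refine Real.injOn_cos (Set.Ioo_subset_Icc_self ha) (Set.Ioo_subset_Icc_self hb) ?_
  unfold mpCoord at hab
  have : 2 * √γ * Real.cos a = 2 * √γ * Real.cos b := by linarith
  exact mul_left_cancel₀ (by positivity) this

lemma hasDerivAt_mpCoord (γ θ : ℝ) :
    HasDerivAt (mpCoord γ) (2 * √γ * -Real.sin θ) θ :=
  ((Real.hasDerivAt_cos θ).const_mul _).const_add _

/-- Under the substitution the square root in the density becomes 2√γ sin θ, and the Jacobian
supplies the same factor again. -/
lemma mpDensity_mpCoord {γ : ℝ} (hγ : 0 < γ) {θ : ℝ} (h : θ ∈ Set.Ioo 0 Real.pi) :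
    |2 * √γ * -Real.sin θ| * mpDensity γ (mpCoord γ θ) =
      2 / Real.pi * (Real.sin θ ^ 2 / mpCoord γ θ) := by
  have hs : 0 < √γ := Real.sqrt_pos.2 hγ
  have h2 := Real.sq_sqrt hγ.le
  have hsin : 0 < Real.sin θ := Real.sin_pos_of_mem_Ioo h
  have hmem : mpCoord γ θ ∈ Set.Icc ((1 - √γ) ^ 2) ((1 + √γ) ^ 2) :=
    Set.Ioo_subset_Icc_self (mpCoord_image hγ ▸ Set.mem_image_of_mem _ h)
  have hpos := mpCoord_pos hγ h
  rw [mpDensity, if_pos hmem, show ((1 + √γ) ^ 2 - mpCoord γ θ) * (mpCoord γ θ - (1 - √γ) ^ 2) =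
    (2 * √γ * Real.sin θ) ^ 2 by
      unfold mpCoord
      have := Real.sin_sq θ
      linear_combination (-4 * √γ ^ 2) * this +
        (4 * √γ * Real.cos θ - (√γ ^ 2 - γ)) * h2, Real.sqrt_sq (by positivity), mul_neg, abs_neg, abs_of_pos (by positivity)]
  field_simp
  rw [h2]

/-- Writing sin² θ = (1 - cos θ)(1 + cos θ) cancels the possible zero of the denominator at π and
leaves the bound 1/√γ. -/
lemma integrableOn_sin_sq_div_mpCoord {γ : ℝ} (hγ : 0 < γ) :
    IntegrableOn (fun θ => Real.sin θ ^ 2 / mpCoord γ θ) (Set.Ioo 0 Real.pi) := by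
  have hs : 0 < √γ := Real.sqrt_pos.2 hγ
  refine Integrable.of_bound (C := (√γ)⁻¹) ?_ ?_
  · refine Measurable.aestronglyMeasurable ?_
    unfold mpCoord
    fun_prop
  · refine (ae_restrict_iff' measurableSet_Ioo).2 (ae_of_all _ fun θ hθ => ?_)
    have hpos := mpCoord_pos hγ hθ
    have h1 := neg_one_lt_cos_of_mem hθ
    have h2 := two_sqrt_mul_le_mpCoord hγ θ
    rw [Real.norm_of_nonneg (by positivity), div_le_iff₀ hpos, inv_mul_eq_div, le_div_iff₀ hs,
      Real.sin_sq]
    nlinarith [Real.cos_le_one θ, mul_pos hs h1]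

lemma mpDensity_eq_indicator (γ : ℝ) :
    mpDensity γ = (Set.Icc ((1 - √γ) ^ 2) ((1 + √γ) ^ 2)).indicator (mpDensity γ) := by
  funext y
  by_cases h : y ∈ Set.Icc ((1 - √γ) ^ 2) ((1 + √γ) ^ 2)
  · rw [Set.indicator_of_mem h]
  · rw [Set.indicator_of_notMem h, mpDensity, if_neg h]

lemma mpDensity_nonneg {γ : ℝ} (hγ : 0 < γ) (y : ℝ) : 0 ≤ mpDensity γ y := by
  unfold mpDensity
  split_ifs with h
  · have hy : 0 ≤ y := (sq_nonneg _).trans h.1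
    have := Real.pi_pos
    positivity
  · exact le_rfl

lemma measurable_mpDensity (γ : ℝ) : Measurable (mpDensity γ) := by
  unfold mpDensity
  exact Measurable.ite measurableSet_Icc (by fun_prop) measurable_const

lemma integrable_mpDensity {γ : ℝ} (hγ : 0 < γ) : Integrable (mpDensity γ) := by
  rw [mpDensity_eq_indicator, integrable_indicator_iff measurableSet_Icc,
    integrableOn_Icc_iff_integrableOn_Ioo, ← mpCoord_image hγ,
    integrableOn_image_iff_integrableOn_abs_deriv_smul measurableSet_Ioo
      (fun θ _ => (hasDerivAt_mpCoord γ θ).hasDerivWithinAt) (mpCoord_injOn hγ)]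
  refine IntegrableOn.congr_fun ((integrableOn_sin_sq_div_mpCoord hγ).const_mul (2 / Real.pi)) ?_
    measurableSet_Ioo
  intro θ hθ
  exact (mpDensity_mpCoord hγ hθ).symm

lemma integral_mpDensity_smul {γ : ℝ} (hγ : 0 < γ) (g : ℝ → ℂ) :
    ∫ y, mpDensity γ y • g y =
      ∫ θ in Set.Ioo 0 Real.pi, (2 / Real.pi * (Real.sin θ ^ 2 / mpCoord γ θ)) •
        g (mpCoord γ θ) := by
  have h1 : ∫ y, mpDensity γ y • g y =
      ∫ y in Set.Icc ((1 - √γ) ^ 2) ((1 + √γ) ^ 2), mpDensity γ y • g y := by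
    rw [← integral_indicator measurableSet_Icc]
    congr 1
    funext y
    rw [Set.indicator_smul_apply_left, ← mpDensity_eq_indicator]
  rw [h1, integral_Icc_eq_integral_Ioo, ← mpCoord_image hγ,
    integral_image_eq_integral_abs_deriv_smul measurableSet_Ioo
      (fun θ _ => (hasDerivAt_mpCoord γ θ).hasDerivWithinAt) (mpCoord_injOn hγ)]
  refine setIntegral_congr_fun measurableSet_Ioo fun θ hθ => ?_
  simp only [smul_smul, mpDensity_mpCoord hγ hθ]

lemma setIntegral_sin_sq_div {u : ℂ} (hu : ‖u‖ < 1) :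
    ∫ θ in Set.Ioo 0 Real.pi, (Real.sin θ : ℂ) ^ 2 / (1 - 2 * u * Real.cos θ + u ^ 2) =
      ((Real.pi / 2 : ℝ) : ℂ) := by
  rw [← integral_sin_sq_div hu, intervalIntegral.integral_of_le Real.pi_pos.le,
    integral_Ioc_eq_integral_Ioo]

/-- The Poisson-type integral with u = -√γ if γ < 1, and with u = -1/√γ after extracting γ if γ > 1.
At γ = 1 the parameter lies on the unit circle, and the integrand is simply (1 - cos θ)/2. -/
lemma setIntegral_sin_sq_div_mpCoord {γ : ℝ} (hγ : 0 < γ) :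
    ∫ θ in Set.Ioo 0 Real.pi, (Real.sin θ : ℂ) ^ 2 / (mpCoord γ θ : ℂ) =
      ((Real.pi / 2 * min 1 (1 / γ) : ℝ) : ℂ) := by
  have hs : 0 < √γ := Real.sqrt_pos.2 hγ
  have h2 := Real.sq_sqrt hγ.le
  have h2C : (√γ : ℂ) ^ 2 = γ := by exact_mod_cast h2
  have hsC : (√γ : ℂ) ≠ 0 := by exact_mod_cast hs.ne'
  rcases lt_trichotomy γ 1 with h | h | h
  · have hu : ‖(-(√γ : ℝ) : ℂ)‖ < 1 := by
      rw [norm_neg, Complex.norm_real, Real.norm_of_nonneg hs.le]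
      exact (Real.sqrt_lt' one_pos).2 (by simpa using h)
    rw [min_eq_left ((one_le_div hγ).2 h.le), mul_one, ← setIntegral_sin_sq_div hu]
    refine setIntegral_congr_fun measurableSet_Ioo fun θ _ => ?_
    simp only [mpCoord]
    push_cast
    rw [neg_sq, h2C]
    ring_nf
  · subst h
    rw [div_one, min_self, mul_one]
    have e : ∫ θ in Set.Ioo 0 Real.pi, (Real.sin θ : ℂ) ^ 2 / (mpCoord 1 θ : ℂ) =
        ∫ θ in Set.Ioo 0 Real.pi, (((1 - Real.cos θ) / 2 : ℝ) : ℂ) := by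
      refine setIntegral_congr_fun measurableSet_Ioo fun θ hθ => ?_
      have hpos := neg_one_lt_cos_of_mem hθ
      have : Real.sin θ ^ 2 / mpCoord 1 θ = (1 - Real.cos θ) / 2 := by
        rw [mpCoord, Real.sqrt_one, Real.sin_sq, div_eq_div_iff (by linarith) two_ne_zero]
        ring
      simp only [← this]
      push_cast
      rfl
    rw [e, integral_complex_ofReal, ← integral_Ioc_eq_integral_Ioo,
      ← intervalIntegral.integral_of_le Real.pi_pos.le, intervalIntegral.integral_div,
      intervalIntegral.integral_sub intervalIntegrable_const
        (Real.continuous_cos.intervalIntegrable _ _)]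
    simp
  · have hu : ‖(-((√γ)⁻¹ : ℝ) : ℂ)‖ < 1 := by
      rw [norm_neg, Complex.norm_real, Real.norm_of_nonneg (by positivity)]
      exact inv_lt_one_of_one_lt₀ (Real.lt_sqrt_of_sq_lt (by simpa using h))
    rw [min_eq_right ((div_le_one hγ).2 h.le)]
    have e : ∫ θ in Set.Ioo 0 Real.pi, (Real.sin θ : ℂ) ^ 2 / (mpCoord γ θ : ℂ) =
        ∫ θ in Set.Ioo 0 Real.pi, (1 / γ : ℂ) * ((Real.sin θ : ℂ) ^ 2 /
          (1 - 2 * (-((√γ)⁻¹ : ℝ) : ℂ) * Real.cos θ + (-((√γ)⁻¹ : ℝ) : ℂ) ^ 2)) := by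
      refine setIntegral_congr_fun measurableSet_Ioo fun θ _ => ?_
      simp only [mpCoord]
      rw [div_mul_div_comm, one_mul]
      congr 1
      push_cast
      rw [← h2C]
      field_simp
      ring
    rw [e, integral_const_mul, setIntegral_sin_sq_div hu]
    push_cast
    ring

/-- The Stieltjes transform of the Marchenko–Pastur law, through the Joukowski parameter. -/
lemma exists_stieltjes_mpLaw_eq {γ : ℝ} (hγ : 0 < γ) {z : ℂ} (hz : 0 < z.im) :
    ∃ u : ℂ, ‖u‖ < 1 ∧ √γ * (1 + u ^ 2) = (z - 1 - γ) * u ∧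
      stieltjes (mpLaw γ) z = (1 + u / √γ) / z := by
  have hs : 0 < √γ := Real.sqrt_pos.2 hγ
  have hsC : (√γ : ℂ) ≠ 0 := by exact_mod_cast hs.ne'
  have hz0 : z ≠ 0 := fun h => by simp [h] at hz
  have hzx : ∀ x : ℝ, z - x ≠ 0 := fun x h => by
    have := congrArg Complex.im h
    simp at this
    exact hz.ne' this
  obtain ⟨u, hu1, hu0, hu⟩ := exists_joukowski (w := (z - 1 - γ) / (2 * √γ)) (by
    rw [show (z - 1 - γ) / (2 * √γ) = (z - 1 - γ) / ((2 * √γ : ℝ) : ℂ) by push_cast; rfl,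
      Complex.div_ofReal_im]
    simp
    exact ⟨hz.ne', hs.ne'⟩)
  have hu' : √γ * (1 + u ^ 2) = (z - 1 - γ) * u := by
    rw [hu]
    field_simp
  refine ⟨u, hu1, hu', ?_⟩
  have hfin : IsFiniteMeasure (volume.withDensity fun y => ENNReal.ofReal (mpDensity γ y)) :=
    isFiniteMeasure_withDensity_ofReal (integrable_mpDensity hγ).2
  have hmeas : Measurable fun x : ℝ => (z - (x : ℂ))⁻¹ := by fun_prop
  have hbound : ∀ x : ℝ, ‖(z - (x : ℂ))⁻¹‖ ≤ (z.im)⁻¹ := fun x => by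
    rw [norm_inv]
    refine inv_anti₀ hz ?_
    have := Complex.abs_im_le_norm (z - x)
    simp at this
    exact (le_abs_self _).trans this
  have hac : ∫ x, (z - (x : ℂ))⁻¹ ∂(volume.withDensity fun y => ENNReal.ofReal (mpDensity γ y)) =
      (min 1 (1 / γ) + u / √γ) / z := by
    rw [integral_withDensity_eq_integral_toReal_smul (measurable_mpDensity γ).ennreal_ofReal
      (ae_of_all _ fun _ => ENNReal.ofReal_lt_top)]
    simp_rw [ENNReal.toReal_ofReal (mpDensity_nonneg hγ _)]
    rw [integral_mpDensity_smul hγ]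
    have hI1 : IntegrableOn (fun θ => (Real.sin θ : ℂ) ^ 2 / (mpCoord γ θ : ℂ))
        (Set.Ioo 0 Real.pi) := by
      have := (integrableOn_sin_sq_div_mpCoord hγ).ofReal (𝕜 := ℂ)
      simpa [IntegrableOn] using this
    have hI2 : IntegrableOn (fun θ => (Real.sin θ : ℂ) ^ 2 / (z - (mpCoord γ θ : ℂ)))
        (Set.Ioo 0 Real.pi) := by
      refine (Continuous.integrableOn_Icc ?_).mono_set Set.Ioo_subset_Icc_self
      refine Continuous.div (by fun_prop) ?_ fun θ => hzx _
      unfold mpCoord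
      fun_prop
    -- Partial fractions: 1/(y(z - y)) = (1/z)(1/y + 1/(z - y)).
    have e : ∀ θ ∈ Set.Ioo 0 Real.pi,
        (2 / Real.pi * (Real.sin θ ^ 2 / mpCoord γ θ)) • (z - (mpCoord γ θ : ℂ))⁻¹ =
        (2 / (Real.pi * z)) * ((Real.sin θ : ℂ) ^ 2 / (mpCoord γ θ : ℂ) +
          (Real.sin θ : ℂ) ^ 2 / (z - (mpCoord γ θ : ℂ))) := by
      intro θ hθ
      have h1 : (mpCoord γ θ : ℂ) ≠ 0 := by exact_mod_cast (mpCoord_pos hγ hθ).ne'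
      have h2 := hzx (mpCoord γ θ)
      have h3 : (Real.pi : ℂ) ≠ 0 := by exact_mod_cast Real.pi_ne_zero
      rw [Complex.real_smul]
      push_cast
      field_simp
      ring
    rw [setIntegral_congr_fun measurableSet_Ioo e, integral_const_mul, integral_add hI1 hI2,
      setIntegral_sin_sq_div_mpCoord hγ]
    have e2 : ∀ θ : ℝ, (Real.sin θ : ℂ) ^ 2 / (z - (mpCoord γ θ : ℂ)) =
        (u / √γ) * ((Real.sin θ : ℂ) ^ 2 / (1 - 2 * u * Real.cos θ + u ^ 2)) := by
      intro θ
      have h1 : u * (z - (mpCoord γ θ : ℂ)) = √γ * (1 - 2 * u * Real.cos θ + u ^ 2) := by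
        simp only [mpCoord]
        push_cast
        linear_combination -hu'
      have h2 := mul_ne_zero hu0 (hzx (mpCoord γ θ))
      rw [div_mul_div_comm, ← h1]
      field_simp
    simp_rw [e2]
    rw [integral_const_mul, setIntegral_sin_sq_div hu1]
    have h3 : (Real.pi : ℂ) ≠ 0 := by exact_mod_cast Real.pi_ne_zero
    push_cast
    field_simp
  rw [stieltjes, mpLaw, integral_add_measure (integrable_of_measurable_bounded hmeas hbound)
    ((integrable_of_measurable_bounded hmeas hbound).smul_measure ENNReal.ofReal_ne_top), hac,
    integral_smul_measure, integral_dirac, ENNReal.toReal_ofReal']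
  -- The atom at 0 supplies exactly the mass missing from the bulk.
  have hmax : ((min 1 (1 / γ) : ℝ) : ℂ) + ((max (1 - 1 / γ) 0 : ℝ) : ℂ) = 1 := by
    have : min 1 (1 / γ) + max (1 - 1 / γ) 0 = 1 := by
      rcases le_total (1 / γ) 1 with h | h
      · rw [min_eq_right h, max_eq_left (by linarith)]
        ring
      · rw [min_eq_left h, max_eq_right (by linarith)]
        ring
    exact_mod_cast this
  rw [Complex.real_smul, Complex.ofReal_zero, sub_zero, ← div_eq_mul_inv, ← add_div]
  congr 1
  linear_combination hmax

end MarchenkoPastur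

/-! ### Consequences of the hypotheses on the entries, on d and on C. -/

section Assumptions

/-- Symmetry kills the odd moments, the case k = 2 gives a fourth moment at most (2C)², and
Cauchy–Schwarz against the unit second moment bounds it below by 1. -/
lemma momentBound_of_symm {ν : Measure ℝ} [IsProbabilityMeasure ν] {C : ℝ} (hC : 2 ≤ C)
    (hsymm : ν.map (fun t => -t) = ν) (hvar : ∫ t, t ^ 2 ∂ν = 1)
    (hmom : ∀ k : ℕ, 1 ≤ k → Integrable (fun t => t ^ (2 * k)) ν ∧
      ∫ t, t ^ (2 * k) ∂ν ≤ (C * k) ^ k) : MomentBound ν (4 * C ^ 2 - 1) := by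
  obtain ⟨h4, h4'⟩ := hmom 2 (by norm_num)
  norm_num at h4 h4'
  have hint : ∀ k ≤ 4, Integrable (fun t : ℝ => t ^ k) ν := by
    intro k hk
    refine ((integrable_const (1 : ℝ)).add h4).mono' (by fun_prop) (ae_of_all _ fun t => ?_)
    simp only [Pi.add_apply]
    rw [norm_pow, Real.norm_eq_abs, ← Even.pow_abs (by decide : Even 4) t]
    rcases le_total |t| 1 with h | h
    · have h1 : |t| ^ k ≤ 1 := pow_le_one₀ (abs_nonneg t) h
      have h2 : 0 ≤ |t| ^ 4 := by positivity
      linarith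
    · have := pow_le_pow_right₀ h hk
      linarith
  have hodd : ∀ k, Odd k → ∫ t, t ^ k ∂ν = 0 := by
    intro k hk
    have h : ∫ t, t ^ k ∂(ν.map fun t => -t) = ∫ t, (-t) ^ k ∂ν :=
      integral_map (by fun_prop) (by fun_prop)
    rw [hsymm] at h
    simp_rw [hk.neg_pow, integral_neg] at h
    linarith
  refine ⟨by nlinarith, hint, hodd 1 (by decide), hvar, hodd 3 (by decide), ?_, ?_⟩
  · have := sq_integral_le (μ := ν) (hint 2 (by norm_num)) (by
      simp_rw [← pow_mul]
      exact h4)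
    rw [hvar] at this
    simp_rw [← pow_mul] at this
    simpa using this
  · linarith [show (C * 2) ^ 2 = 4 * C ^ 2 by ring]

/-- From d·binom(n, d) = n·binom(n - 1, d - 1) ≥ n and d < √n. It ensures N → ∞, hence p → ∞. -/
lemma sqrt_le_choose {n d : ℕ} (hd : 1 ≤ d) (hdn : (d : ℝ) < √(n : ℝ)) :
    √(n : ℝ) ≤ n.choose d := by
  have hn : 0 < √(n : ℝ) := lt_of_le_of_lt (by positivity) hdn
  have hn0 : (0 : ℝ) < n := Real.sqrt_pos.1 hn
  have hle : d ≤ n := by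
    have h1 : (1 : ℝ) ≤ n := by exact_mod_cast (by exact_mod_cast hn0 : 0 < n)
    have : (d : ℝ) ≤ n := hdn.le.trans (Real.sqrt_le_iff.2 ⟨hn0.le, by nlinarith⟩)
    exact_mod_cast this
  obtain ⟨e, rfl⟩ : ∃ e, d = e + 1 := ⟨d - 1, by omega⟩
  obtain ⟨m, rfl⟩ : ∃ m, n = m + 1 := ⟨n - 1, by omega⟩
  have h1 := Nat.add_one_mul_choose_eq m e
  have h2 : 1 ≤ m.choose e := Nat.choose_pos (by omega)
  have h3 : ((m + 1 : ℕ) : ℝ) ≤ (m + 1).choose (e + 1) * ((e + 1 : ℕ) : ℝ) := by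
    have : m + 1 ≤ (m + 1).choose (e + 1) * (e + 1) := by nlinarith
    exact_mod_cast this
  have h4 : √((m + 1 : ℕ) : ℝ) * √((m + 1 : ℕ) : ℝ) ≤
      (m + 1).choose (e + 1) * √((m + 1 : ℕ) : ℝ) := by
    rw [Real.mul_self_sqrt hn0.le]
    refine h3.trans ?_
    gcongr
  exact le_of_mul_le_mul_right h4 hn

/-- Put ρ = √n/d. As log C ≥ log 2, the limit hypothesis forces log ρ → ∞; it also gives C² ≤ ρ
eventually, so the expression is at most 8ρ · ρ⁻² = 8/ρ. -/
lemma tendsto_exponent_zero {d : ℕ → ℕ} {C : ℕ → ℝ}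
    (hd : ∀ᶠ n in atTop, 1 ≤ d n ∧ (d n : ℝ) < √(n : ℝ)) (hC : ∀ᶠ n in atTop, 2 ≤ C n)
    (hlim : Tendsto (fun n => Real.log (C n) / Real.log (√(n : ℝ) / (d n : ℝ))) atTop (𝓝 0)) :
    Tendsto (fun n : ℕ => 2 * (d n : ℝ) * ((4 * C n ^ 2 - 1) * (d n / n))) atTop (𝓝 0) := by
  have hpos : ∀ᶠ n : ℕ in atTop, 0 < Real.log (√(n : ℝ) / (d n : ℝ)) := by
    filter_upwards [hd] with n hn
    have : (0 : ℝ) < d n := by exact_mod_cast hn.1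
    exact Real.log_pos ((one_lt_div this).2 hn.2)
  have hlog2 : 0 < Real.log 2 := Real.log_pos one_lt_two
  have hlogC : ∀ᶠ n in atTop, Real.log 2 ≤ Real.log (C n) := by
    filter_upwards [hC] with n hn
    exact Real.log_le_log two_pos hn
  have htop : Tendsto (fun n : ℕ => Real.log (√(n : ℝ) / (d n : ℝ))) atTop atTop := by
    rw [tendsto_atTop]
    intro b
    have hb : 0 < max b 1 := lt_max_of_lt_right one_pos
    filter_upwards [hpos, hlogC, hlim.eventually_lt_const (div_pos hlog2 hb)] with n h1 h2 h3
    rw [div_lt_div_iff₀ h1 hb] at h3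
    refine (le_max_left b 1).trans (le_of_lt ?_)
    by_contra! hcon
    nlinarith
  have hexp : Tendsto (fun n : ℕ => 8 * Real.exp (-Real.log (√(n : ℝ) / (d n : ℝ)))) atTop
      (𝓝 0) := by
    simpa using (Real.tendsto_exp_neg_atTop_nhds_zero.comp htop).const_mul 8
  refine squeeze_zero' ?_ ?_ hexp
  · filter_upwards [hC] with n hn
    have : 0 ≤ 4 * C n ^ 2 - 1 := by nlinarith
    positivity
  · filter_upwards [hpos, hC, hd, hlim.eventually_lt_const (by norm_num : (0 : ℝ) < 1 / 2)]
      with n h1 h2 h3 h4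
    have hdp : (0 : ℝ) < d n := by exact_mod_cast h3.1
    have hsn : 0 < √(n : ℝ) := hdp.trans h3.2
    have hn : (0 : ℝ) < n := Real.sqrt_pos.1 hsn
    have hρ : 0 < √(n : ℝ) / (d n : ℝ) := by positivity
    have hlog : 2 * Real.log (C n) ≤ Real.log (√(n : ℝ) / (d n : ℝ)) := by
      rw [div_lt_div_iff₀ h1 two_pos] at h4
      linarith
    have hC2 : C n ^ 2 ≤ √(n : ℝ) / (d n : ℝ) := by
      rw [← Real.log_le_log_iff (by positivity) hρ, Real.log_pow]
      exact_mod_cast hlog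
    have hsq : (d n : ℝ) / n * d n = (√(n : ℝ) / (d n : ℝ))⁻¹ ^ 2 := by
      rw [inv_div, div_pow, Real.sq_sqrt hn.le]
      ring
    rw [Real.exp_neg, Real.exp_log hρ]
    set ρ := √(n : ℝ) / (d n : ℝ)
    calc 2 * (d n : ℝ) * ((4 * C n ^ 2 - 1) * (d n / n))
        = 2 * (4 * C n ^ 2 - 1) * ((d n : ℝ) / n * d n) := by ring
      _ ≤ 2 * (4 * ρ) * ((d n : ℝ) / n * d n) := by
          gcongr
          linarith
      _ = 8 * ρ⁻¹ := by
          rw [hsq]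
          field_simp
          ring

end Assumptions

/-! ### Stability of the Marchenko–Pastur equation. -/

section Stability

/-- Approximate solutions of the Marchenko–Pastur equation are close to the exact one. -/
lemma norm_sub_stieltjes_mpLaw_le {γ : ℝ} (hγ : 0 < γ) {z : ℂ} (hz : 16 / 9 + 4 * γ ≤ z.im)
    {g : ℝ} (hg : 0 < g) (hgz : g ≤ z.im / 4) {M δ : ℂ} (hM : ‖M‖ ≤ (z.im)⁻¹)
    (hδ : g * (z * M) + 1 - g = 1 / (1 - g * M) + δ) :
    ‖M - stieltjes (mpLaw γ) z‖ ≤ 3 * (4 / 3 * (1 + √γ) * (|g - γ| * (z.im)⁻¹ *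
      ‖stieltjes (mpLaw γ) z‖) + ‖δ‖ / g) := by
  have him : 0 < z.im := by linarith
  have hz0 : z ≠ 0 := fun h => by simp [h] at him
  have hs : 0 < √γ := Real.sqrt_pos.2 hγ
  have hsq := Real.sq_sqrt hγ.le
  have hsC : (√γ : ℂ) ≠ 0 := by exact_mod_cast hs.ne'
  have hsqC : (√γ : ℂ) ^ 2 = γ := by exact_mod_cast hsq
  obtain ⟨u, hu1, hu, hst⟩ := exists_stieltjes_mpLaw_eq hγ him
  set m := stieltjes (mpLaw γ) z
  have hm1 : z * m - 1 = u / √γ := by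
    rw [hst]
    field_simp
    ring
  -- The factor 1 + √γ u is 1/(1 - γm); since |u| < 1 it is at most 1 + √γ in norm, with no separate
  -- estimate of 1 - γm.
  have hm2 : (1 - γ * m) * (1 + √γ * u) = 1 := by
    rw [hst]
    field_simp
    rw [← hsqC]
    rw [← hsqC] at hu
    linear_combination (-√γ ^ 2 : ℂ) * hu
  have hm3 : z * m - 1 = m * (1 + √γ * u) := by
    have h : (γ : ℂ) * (z * m - 1) = γ * (m * (1 + √γ * u)) := by
      have hx : (γ : ℂ) * (z * m - 1) = √γ * u := by
        rw [hm1, ← hsqC]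
        field_simp
      linear_combination hx + hm2
    exact mul_left_cancel₀ (by exact_mod_cast hγ.ne') h
  have hc : ‖(g : ℂ) * M‖ ≤ 1 / 4 := by
    rw [norm_mul, Complex.norm_real, Real.norm_of_nonneg hg.le]
    calc g * ‖M‖ ≤ z.im / 4 * (z.im)⁻¹ := by gcongr
      _ = 1 / 4 := by field_simp
  have hc1 : 3 / 4 ≤ ‖1 - (g : ℂ) * M‖ := by
    have := norm_sub_norm_le (1 : ℂ) (g * M)
    rw [norm_one] at this
    linarith
  have hc0 : 1 - (g : ℂ) * M ≠ 0 := norm_pos_iff.1 (by linarith)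
  have hgC : (g : ℂ) ≠ 0 := by exact_mod_cast hg.ne'
  have hM1 : z * M - 1 = M * (1 / (1 - g * M)) + δ / g := by
    have h : (g : ℂ) * (z * M - 1) = g * (M * (1 / (1 - g * M)) + δ / g) := by
      have e : (1 : ℂ) / (1 - g * M) = 1 + g * M * (1 / (1 - g * M)) := by
        field_simp
        ring
      rw [mul_add, mul_div_cancel₀ _ hgC]
      linear_combination hδ + e
    exact mul_left_cancel₀ hgC h
  -- Subtract zm - 1 = m/(1 - γm) from its perturbed version for M and put both over the common
  -- denominator (1 - gM)(1 - γm).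
  have hkey : z * (M - m) = (1 + √γ * u) * (1 / (1 - g * M)) *
      ((M - m) + (g - γ) * M * m) + δ / g := by
    have e1 : M * (1 / (1 - g * M)) = (1 + √γ * u) * (1 / (1 - g * M)) * (M * (1 - γ * m)) := by
      linear_combination (-(M * (1 / (1 - g * M)))) * hm2
    have e2 : m * (1 + √γ * u) = (1 + √γ * u) * (1 / (1 - g * M)) * (m * (1 - g * M)) := by
      field_simp
    calc z * (M - m) = (z * M - 1) - (z * m - 1) := by ring
      _ = M * (1 / (1 - g * M)) + δ / g - m * (1 + √γ * u) := by rw [hM1, hm3]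
      _ = _ := by
        rw [e2, e1]
        ring
  have hn1 : ‖(1 : ℂ) + √γ * u‖ ≤ 1 + √γ := by
    refine (norm_add_le _ _).trans ?_
    rw [norm_one, norm_mul, Complex.norm_real, Real.norm_of_nonneg hs.le]
    nlinarith
  have hn2 : ‖(1 : ℂ) / (1 - g * M)‖ ≤ 4 / 3 := by
    rw [norm_div, norm_one, div_le_iff₀ (by linarith)]
    linarith
  have hn3 : ‖(M - m) + (g - γ) * M * m‖ ≤ ‖M - m‖ + |g - γ| * (z.im)⁻¹ * ‖m‖ := by
    refine (norm_add_le _ _).trans ?_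
    rw [norm_mul, norm_mul, ← Complex.ofReal_sub, Complex.norm_real, Real.norm_eq_abs]
    gcongr
  have hfin : z.im * ‖M - m‖ ≤ 4 / 3 * (1 + √γ) * (‖M - m‖ + |g - γ| * (z.im)⁻¹ * ‖m‖) +
      ‖δ‖ / g := by
    calc z.im * ‖M - m‖ ≤ ‖z‖ * ‖M - m‖ := by
          gcongr
          exact (le_abs_self _).trans (Complex.abs_im_le_norm z)
      _ = ‖(1 + √γ * u) * (1 / (1 - g * M)) * ((M - m) + (g - γ) * M * m) + δ / g‖ := by
          rw [← norm_mul, hkey]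
      _ ≤ (1 + √γ) * (4 / 3) * (‖M - m‖ + |g - γ| * (z.im)⁻¹ * ‖m‖) + ‖δ‖ / g := by
          refine (norm_add_le _ _).trans (add_le_add ?_ (le_of_eq ?_))
          · rw [norm_mul, norm_mul]
            gcongr
          · rw [norm_div, Complex.norm_real, Real.norm_of_nonneg hg.le]
      _ = _ := by ring
  -- With the assumed lower bound on Im z, the right side is at least (2√γ - 1/3)² + 1/3. This
  -- explains the constant 16/9, and 1/3 gives the factor 3 in the conclusion.
  have hgap : 1 / 3 ≤ z.im - 4 / 3 * (1 + √γ) := by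
    nlinarith [sq_nonneg (2 * √γ - 1 / 3)]
  nlinarith [norm_nonneg (M - m), mul_le_mul_of_nonneg_right hgap (norm_nonneg (M - m))]

end Stability

/-! ### Collecting the estimates and passing to the limit. -/

section Assembly

/-- The bound for the `L¹` distance between the quadratic form and its approximation. -/
def quadError (n d p : ℕ) (L y : ℝ) : ℝ :=
  y⁻¹ * ((n.choose d : ℝ) / p * √(Real.exp (2 * d * (L * (d / n))) - 1) + (p : ℝ)⁻¹ +
    4 * (√p)⁻¹)

/-- What holds for a matrix of fixed size. -/
lemma fixed_size_estimates {n d p : ℕ} [NeZero p] {ν : Measure ℝ} [IsProbabilityMeasure ν]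
    {L : ℝ} (hν : MomentBound ν L) (hdn : d ≤ n) (hn : 0 < n)
    {Ω : Type*} [MeasurableSpace Ω] {P : Measure Ω}
    {Z : Fin p → Ω → Row n d → ℝ} (hindep : iIndepFun Z P)
    (hlaw : ∀ j, HasLaw (Z j) (tensorLaw n d ν) P) {z : ℂ} (hz : 0 < z.im) :
    Integrable (fun ω => 1 / (1 - quadForm (fun j => Z j ω) 0 z)) P ∧
    Integrable (fun ω => stieltjesESD (sampleCov fun j => Z j ω) z) P ∧
    ‖∫ ω, stieltjesESD (sampleCov fun j => Z j ω) z ∂P‖ ≤ (z.im)⁻¹ ∧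
    ∫ ω, 1 / (1 - quadForm (fun j => Z j ω) 0 z) ∂P =
      (n.choose d : ℂ) / p * (z * ∫ ω, stieltjesESD (sampleCov fun j => Z j ω) z ∂P) + 1 -
        (n.choose d : ℂ) / p ∧
    (1 - (n.choose d : ℂ) / p * (∫ ω, stieltjesESD (sampleCov fun j => Z j ω) z ∂P) ≠ 0 →
      ‖(∫ ω, 1 / (1 - quadForm (fun j => Z j ω) 0 z) ∂P) -
        1 / (1 - (n.choose d : ℂ) / p * ∫ ω, stieltjesESD (sampleCov fun j => Z j ω) z ∂P)‖ ≤
      ‖z‖ / z.im * ‖1 / (1 - (n.choose d : ℂ) / p *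
        ∫ ω, stieltjesESD (sampleCov fun j => Z j ω) z ∂P)‖ * quadError n d p L z.im) := by
  have e1 : ∫ ω, stieltjesESD (sampleCov fun j => Z j ω) z ∂P =
      ∫ x : Fin p → Row n d → ℝ, stieltjesESD (sampleCov x) z
        ∂(Measure.pi fun _ => tensorLaw n d ν) :=
    integral_eq_integral_pi hindep hlaw (measurable_stieltjesESD z)
  have e2 : ∫ ω, 1 / (1 - quadForm (fun j => Z j ω) 0 z) ∂P =
      ∫ x : Fin p → Row n d → ℝ, 1 / (1 - quadForm x 0 z)
        ∂(Measure.pi fun _ => tensorLaw n d ν) :=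
    integral_eq_integral_pi hindep hlaw (f := fun x => 1 / (1 - quadForm x 0 z))
      (measurable_const.div (measurable_const.sub (measurable_quadForm 0 z)))
  rw [e1, e2]
  exact ⟨integrable_of_integrable_pi hindep hlaw (f := fun x => 1 / (1 - quadForm x 0 z))
      (integrable_one_div_one_sub_quadForm 0 hz),
    integrable_of_integrable_pi hindep hlaw (f := fun x => stieltjesESD (sampleCov x) z)
      (integrable_stieltjesESD hz),
    norm_integral_stieltjesESD_le hz, integral_one_div_one_sub_quadForm_eq hz hdn,
    fun hc => norm_integral_one_div_sub_le hz hc (integral_norm_quadForm_sub_le hν hdn hn hz)⟩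

lemma tendsto_quadError_zero {d p : ℕ → ℕ} [∀ n, NeZero (p n)] {γ : ℝ} {L : ℕ → ℝ} (y : ℝ)
    (hd : ∀ᶠ n in atTop, 1 ≤ d n ∧ (d n : ℝ) < √(n : ℝ))
    (hratio : Tendsto (fun n => (n.choose (d n) : ℝ) / (p n : ℝ)) atTop (𝓝 γ))
    (hL : Tendsto (fun n : ℕ => 2 * (d n : ℝ) * (L n * (d n / n))) atTop (𝓝 0)) :
    Tendsto (fun n => quadError n (d n) (p n) (L n) y) atTop (𝓝 0) := by
  have hN : Tendsto (fun n : ℕ => (n.choose (d n) : ℝ)) atTop atTop := by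
    refine tendsto_atTop_mono' atTop ?_
      (Real.tendsto_sqrt_atTop.comp tendsto_natCast_atTop_atTop)
    filter_upwards [hd] with n hn
    exact sqrt_le_choose hn.1 hn.2
  -- Here 1/p = (N/p) · (1/N), a convergent factor times a vanishing one.
  have hp : Tendsto (fun n => ((p n : ℕ) : ℝ)⁻¹) atTop (𝓝 0) := by
    have h := hratio.mul (tendsto_inv_atTop_zero.comp hN)
    rw [mul_zero] at h
    refine h.congr' ?_
    filter_upwards [hN.eventually_gt_atTop 0] with n hn
    have hp0 : ((p n : ℕ) : ℝ) ≠ 0 := by exact_mod_cast NeZero.ne (p n)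
    simp only [Function.comp]
    field_simp
  have hsp : Tendsto (fun n => (√((p n : ℕ) : ℝ))⁻¹) atTop (𝓝 0) := by
    have := (Real.continuous_sqrt.tendsto 0).comp hp
    simpa [Function.comp_def] using this
  have hexp : Tendsto (fun n : ℕ => √(Real.exp (2 * (d n : ℝ) * (L n * (d n / n))) - 1)) atTop
      (𝓝 0) := by
    have hc : Continuous fun t : ℝ => √(Real.exp t - 1) := by fun_prop
    have := (hc.tendsto 0).comp hL
    simpa [Function.comp_def] using this
  unfold quadError
  simpa using (((hratio.mul hexp).add hp).add (hsp.const_mul 4)).const_mul y⁻¹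

end Assembly

end RandomTensor

end

open RandomTensor in
theorem mainTheorem3
    -- `d`, `p` with `N / p → γ > 0`, where `N = n.choose d`
    (d p : ℕ → ℕ) [∀ n, NeZero (p n)] (γ : ℝ) (hγ : 0 < γ)
    (hd : ∀ᶠ n in atTop, 1 ≤ d n ∧ (d n : ℝ) < √(n : ℝ))
    (hratio : Tendsto (fun n => (n.choose (d n) : ℝ) / (p n : ℝ)) atTop (𝓝 γ))
    -- `ν n` is the law of `x = x(n)`
    (ν : ℕ → Measure ℝ) [∀ n, IsProbabilityMeasure (ν n)]
    (C : ℕ → ℝ) (hC : ∀ᶠ n in atTop, 2 ≤ C n)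
    (hsymm : ∀ᶠ n in atTop, (ν n).map (fun t => -t) = ν n)
    (hvar : ∀ᶠ n in atTop, ∫ t, t ^ 2 ∂(ν n) = 1)
    (hmom : ∀ᶠ n in atTop, ∀ k : ℕ, 1 ≤ k →
      Integrable (fun t => t ^ (2 * k)) (ν n) ∧ ∫ t, t ^ (2 * k) ∂(ν n) ≤ (C n * k) ^ k)
    (hlim : Tendsto (fun n => Real.log (C n) / Real.log (√(n : ℝ) / (d n : ℝ))) atTop (𝓝 0))
    -- `Z n j`, for `j : Fin (p n)`, are the i.i.d. columns
    {Ω : ℕ → Type*} [∀ n, MeasurableSpace (Ω n)]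
    (P : ∀ n, Measure (Ω n)) [∀ n, IsProbabilityMeasure (P n)]
    (Z : ∀ n, Fin (p n) → Ω n → Row n (d n) → ℝ)
    (hindep : ∀ᶠ n in atTop, iIndepFun (Z n) (P n))
    (hlaw : ∀ᶠ n in atTop, ∀ j, HasLaw (Z n j) (tensorLaw n (d n) (ν n)) (P n)) :
    (∀ z : ℂ, 1 + 4 * γ ≤ z.im →
      -- all the quantities involved are well defined
      (∀ᶠ n in atTop,
        (∀ ω, 1 - quadForm (fun j => Z n j ω) 0 z ≠ 0) ∧
        Integrable (fun ω => 1 / (1 - quadForm (fun j => Z n j ω) 0 z)) (P n) ∧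
        Integrable (fun ω => stieltjesESD (sampleCov fun j => Z n j ω) z) (P n) ∧
        1 - ((n.choose (d n) : ℂ) / (p n : ℂ)) *
          (∫ ω, stieltjesESD (sampleCov fun j => Z n j ω) z ∂(P n)) ≠ 0) ∧
      Tendsto (fun n =>
        (∫ ω, 1 / (1 - quadForm (fun j => Z n j ω) 0 z) ∂(P n)) -
          1 / (1 - ((n.choose (d n) : ℂ) / (p n : ℂ)) *
            (∫ ω, stieltjesESD (sampleCov fun j => Z n j ω) z ∂(P n))))
        atTop (𝓝 0)) ∧
    (∀ z : ℂ, 16 / 9 + 4 * γ ≤ z.im →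
      Tendsto (fun n => ∫ ω, stieltjesESD (sampleCov fun j => Z n j ω) z ∂(P n))
        atTop (𝓝 (stieltjes (mpLaw γ) z))) := by
  have hest := fun (z : ℂ) (hz : 0 < z.im) => show ∀ᶠ n in atTop, _ from by
    filter_upwards [hd, hC, hsymm, hvar, hmom, hindep, hlaw] with n h1 h2 h3 h4 h5 h6 h7
    have hdp : (0 : ℝ) < d n := by exact_mod_cast h1.1
    have hn : (0 : ℝ) < n := Real.sqrt_pos.1 (hdp.trans h1.2)
    have hn1 : (1 : ℝ) ≤ n := by exact_mod_cast (by exact_mod_cast hn : 0 < n)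
    have hdn : (d n : ℝ) ≤ n := h1.2.le.trans (Real.sqrt_le_iff.2 ⟨hn.le, by nlinarith⟩)
    exact fixed_size_estimates (momentBound_of_symm h2 h3 h4 h5) (by exact_mod_cast hdn)
      (by exact_mod_cast hn) h6 h7 hz
  have hcast : ∀ n, (n.choose (d n) : ℂ) / (p n : ℂ) =
      (((n.choose (d n) : ℝ) / (p n : ℝ) : ℝ) : ℂ) := fun n => by push_cast; rfl
  have hg0 : ∀ n, 0 ≤ (n.choose (d n) : ℝ) / (p n : ℝ) := fun n => by positivity
  -- Because γ < Im z / 2 and |M| ≤ 1/Im z, eventually |gM| ≤ 1/2.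
  have hhalf : ∀ z : ℂ, 1 + 4 * γ ≤ z.im → ∀ᶠ n in atTop,
      1 / 2 ≤ ‖1 - ((n.choose (d n) : ℂ) / (p n : ℂ)) *
        (∫ ω, stieltjesESD (sampleCov fun j => Z n j ω) z ∂(P n))‖ := by
    intro z hz
    have him : 0 < z.im := by linarith
    filter_upwards [hest z him, hratio.eventually_lt_const (by linarith : γ < z.im / 2)]
      with n h1 h2
    have h3 : ‖((n.choose (d n) : ℂ) / (p n : ℂ)) *
        (∫ ω, stieltjesESD (sampleCov fun j => Z n j ω) z ∂(P n))‖ ≤ 1 / 2 := by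
      rw [hcast, norm_mul, Complex.norm_real, Real.norm_of_nonneg (hg0 n)]
      calc _ ≤ z.im / 2 * (z.im)⁻¹ := by
            gcongr
            exact h1.2.2.1
        _ = 1 / 2 := by field_simp
    have h4 := norm_sub_norm_le (1 : ℂ) (((n.choose (d n) : ℂ) / (p n : ℂ)) *
      (∫ ω, stieltjesESD (sampleCov fun j => Z n j ω) z ∂(P n)))
    rw [norm_one] at h4
    linarith
  have hquad : ∀ z : ℂ, 1 + 4 * γ ≤ z.im → Tendsto (fun n =>
      (∫ ω, 1 / (1 - quadForm (fun j => Z n j ω) 0 z) ∂(P n)) -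
        1 / (1 - ((n.choose (d n) : ℂ) / (p n : ℂ)) *
          (∫ ω, stieltjesESD (sampleCov fun j => Z n j ω) z ∂(P n)))) atTop (𝓝 0) := by
    intro z hz
    have him : 0 < z.im := by linarith
    have herr := (tendsto_quadError_zero z.im hd hratio
      (tendsto_exponent_zero hd hC hlim)).const_mul (‖z‖ / z.im * 2)
    rw [mul_zero] at herr
    refine squeeze_zero_norm' ?_ herr
    filter_upwards [hest z him, hhalf z hz] with n h1 h2
    refine (h1.2.2.2.2 (norm_pos_iff.1 (by linarith))).trans ?_
    have h3 : 0 ≤ quadError n (d n) (p n) (4 * C n ^ 2 - 1) z.im := by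
      unfold quadError
      positivity
    gcongr
    rw [norm_div, norm_one, div_le_iff₀ (by linarith)]
    linarith
  refine ⟨fun z hz => ⟨?_, hquad z hz⟩, fun z hz => ?_⟩
  · have him : 0 < z.im := by linarith
    filter_upwards [hest z him, hhalf z hz] with n h1 h2
    exact ⟨fun ω => one_sub_quadForm_ne_zero _ 0 him, h1.1, h1.2.1,
      norm_pos_iff.1 (by linarith)⟩
  · have hz1 : 1 + 4 * γ ≤ z.im := by linarith
    have him : 0 < z.im := by linarith
    rw [tendsto_iff_norm_sub_tendsto_zero]
    have hδ := (hquad z hz1).norm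
    rw [norm_zero] at hδ
    have hgap : Tendsto (fun n => |(n.choose (d n) : ℝ) / (p n : ℝ) - γ|) atTop (𝓝 0) := by
      have := (hratio.sub_const γ).abs
      rwa [sub_self, abs_zero] at this
    have hbound := (((((hgap.mul_const (z.im)⁻¹).mul_const ‖stieltjes (mpLaw γ) z‖).const_mul
      (4 / 3 * (1 + √γ)))).add (hδ.div hratio hγ.ne')).const_mul 3
    simp only [zero_mul, mul_zero, zero_div, add_zero] at hbound
    refine squeeze_zero' (Eventually.of_forall fun _ => norm_nonneg _) ?_ hbound
    filter_upwards [hest z him, hratio.eventually_lt_const (by linarith : γ < z.im / 4),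
      hratio.eventually_const_lt hγ] with n h1 h2 h3
    -- The error δ is the difference that tends to 0 in the first claim; the exact trace identity
    -- rewrites its first term as gzM + 1 - g.
    refine norm_sub_stieltjes_mpLaw_le hγ hz h3 h2.le h1.2.2.1 ?_
    rw [← hcast, h1.2.2.2.1]
    ring
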